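/- A composition is a finite list $\alpha=(\alpha_1,\dots,\alpha_l)$ of positive integers (possibly empty), with length $l(\alpha)=l$ and size $|\alpha|=\sum_i\alpha_i$; put $\mathrm{set}(\alpha)=\{\alpha_1,\alpha_1+\alpha_2,\dots,\alpha_1+\cdots+\alpha_{l-1}\}$, and write $\alpha\succcurlyeq\beta$ if $\alpha$ is obtained from $\beta$ by adding together adjacent parts. Let $\mathbf{NSym}=\mathbb{Q}\langle \mathbf h_1,\mathbf h_2,\dots\rangle$ be the free associative algebra, $\mathbf h_\alpha=\mathbf h_{\alpha_1}\cdots\mathbf h_{\alpha_l}$, and $$\mathbf r_\beta=\sum_{\alpha\succcurlyeq\beta}(-1)^{l(\beta)-l(\alpha)}\mathbf h_\alpha,\qquad \Psi_n=\sum_{k=0}^{n-1}(-1)^k\,\mathbf r_{(1^k,n-k)}\quad(n\ge 1).$$ The diagram of $\alpha$ has $\alpha_i$ left-justified boxes in row $i$, rows being numbered from top to bottom; $(i,j)$ is the box in row $i$ and column $j$. A standard reverse composition tableau (SRCT) of shape $\alpha$ is a bijective filling $\tau$ of the boxes of $\alpha$ with $1,\dots,|\alpha|$ whose rows decrease from left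 to right, whose first column increases from top to bottom, and such that whenever $i<j$, $(i,k),(j,k+1)\in\alpha$ and $\tau(i,k)\ge\tau(j,k+1)$, then $(i,k+1)\in\alpha$ and $\tau(i,k+1)>\tau(j,k+1)$. Its descent set consists of all $v$ such that $v+1$ lies in a column weakly to the right of that of $v$; its descent composition is the composition $\beta$ of $|\alpha|$ with $\mathrm{set}(\beta)$ equal to the descent set. The noncommutative Schur functions $\mathbf s_\alpha\in\mathbf{NSym}$ are determined by $$\mathbf r_\beta=\sum_{|\alpha|=|\beta|}d_{\alpha,\beta}\,\mathbf s_\alpha\quad\text{for all compositions }\beta,$$ where $d_{\alpha,\beta}$ is the number of SRCTs of shape $\alpha$ and descent composition $\beta$. For $i\ge1$ the box-adding operator $\mathfrak t_i$ acts on compositions as follows: $\mathfrak t_1(\alpha)=(1,\alpha_1,\dots,\alpha_l)$; for $i\ge2$, $\mathfrak t_i(\alpha)$ is obtained from $\alpha$ by replacing the leftmost part equal to $i-1$ with $i$, and $\mathfrak t_i(\alpha)=0$ if there is no such part. A word $w=\mathfrak t_{i_1}\cdots\mathfrak t_{i_n}$ acts by composition (the rightmost letter first; $\mathfrak t_i(0)=0$),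 and $w(\alpha)$ is identified with the element $\mathbf s_{w(\alpha)}$ of $\mathbf{NSym}$, which is $0$ if $w(\alpha)=0$. For $0\le k\le n-1$ let $RHW_{n,k}$ be the set of reverse $k$-hookwords of length $n$, i.e. words with $i_1\le i_2\le\cdots\le i_{k+1}>i_{k+2}>\cdots>i_n$; for such a word put $\mathrm{asc}(w)=k$ (the number $k$ is determined by $w$). Let $CRHW_n$ be the set of those $w\in\bigcup_{k=0}^{n-1}RHW_{n,k}$ that are connected, i.e. for which the set $\{i_1,\dots,i_n\}$ is an interval of integers. Then, for every integer $n\ge1$ and every composition $\alpha$: (1) for every $0\le k\le n-1$, $$\mathbf r_{(1^k,n-k)}\cdot\mathbf s_\alpha=\sum_{w\in RHW_{n,k}}w(\alpha);$$ (2) $$\Psi_n\cdot\mathbf s_\alpha=\sum_{w\in CRHW_n}(-1)^{\mathrm{asc}(w)}\,w(\alpha).$$ In both sums only finitely many words $w$ satisfy $w(\alpha)\ne0$. -/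

import Mathlib

namespace NSymMN

/-! ### Compositions

A composition is a finite ordered list of positive integers, i.e. a term of `List ℕ+`. -/

/-- The size `|α|`: the sum of the parts. -/
def size (α : List ℕ+) : ℕ := (α.map (fun a : ℕ+ => (a : ℕ))).sum

/-- The compositions of `n`. -/
abbrev CompOf (n : ℕ) : Type := {α : List ℕ+ // size α = n}

lemma length_le_size (α : List ℕ+) : α.length ≤ size α := by
  induction α with
  | nil => simp
  | cons a l ih =>
    have := a.pos
    simp only [size, List.length_cons, List.map_cons, List.sum_cons] at *
    omega

lemma le_size_of_mem {α : List ℕ+} {a : ℕ+} (h : a ∈ α) : (a : ℕ) ≤ size α :=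
  List.le_sum_of_mem (List.mem_map_of_mem h)

instance (n : ℕ) : Finite (CompOf n) := by
  have h1 : (Set.Iic (⟨n + 1, Nat.succ_pos n⟩ : ℕ+)).Finite := Set.finite_Iic _
  have h2 : {l : List ℕ+ | l.length ≤ n ∧ ∀ a ∈ l, a ∈ Set.Iic (⟨n + 1, Nat.succ_pos n⟩ : ℕ+)}.Finite := by
    have := h1.to_subtype
    refine ((List.finite_length_le (Set.Iic (⟨n + 1, Nat.succ_pos n⟩ : ℕ+)) n).image
      (List.map Subtype.val)).subset ?_
    rintro l ⟨hl, hm⟩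
    refine ⟨l.attach.map (fun a => ⟨a.1, hm a.1 a.2⟩), ?_, ?_⟩
    · rw [Set.mem_ofPred_eq, List.length_map, List.length_attach]; exact hl
    · rw [List.map_map]; exact List.attach_map_subtype_val l
  refine Set.Finite.to_subtype (h2.subset ?_)
  rintro l (rfl : size l = n)
  refine ⟨length_le_size l, fun a ha => ?_⟩
  have := le_size_of_mem ha
  change (a : ℕ) ≤ size l + 1
  omega

noncomputable instance (n : ℕ) : Fintype (CompOf n) := Fintype.ofFinite _

/-- `set(α) = {α₁, α₁ + α₂, …, α₁ + ⋯ + α_{l-1}}` for `α = (α₁, …, α_l)`. -/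
def partialSums (α : List ℕ+) : Set ℕ :=
  {s | ∃ m, 0 < m ∧ m < α.length ∧ s = size (α.take m)}

/-- The refinement order: `Coarser α β` (written `α ≽ β`) holds if the parts of `α` are obtained,
in order, by adding together adjacent parts of `β`. -/
def Coarser (α β : List ℕ+) : Prop :=
  ∃ L : List (List ℕ+), L.flatten = β ∧ L.map size = α.map (fun a : ℕ+ => (a : ℕ))

/-! ### Noncommutative symmetric functions -/

/-- The algebra of noncommutative symmetric functions `ℚ⟨h₁, h₂, …⟩`. -/
abbrev NSym : Type := FreeAlgebra ℚ ℕ+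

/-- `h_α = h_{α₁} ⋯ h_{α_l}`. -/
noncomputable def hprod (α : List ℕ+) : NSym := (α.map (FreeAlgebra.ι ℚ)).prod

open Classical in
/-- The noncommutative ribbon Schur function
`r_β = ∑_{α ≽ β} (-1)^{l(β) - l(α)} h_α`. -/
noncomputable def ribbon (β : List ℕ+) : NSym :=
  ∑ α : CompOf (size β),
    if Coarser α.1 β then (-1 : ℚ) ^ (β.length - α.1.length) • hprod α.1 else 0

/-- The composition `(1^k, n - k)`, for `0 ≤ k ≤ n - 1`. -/
def hookComp (n k : ℕ) (hk : k < n) : List ℕ+ :=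
  List.replicate k 1 ++ [⟨n - k, Nat.sub_pos_of_lt hk⟩]

/-- The noncommutative power sum of the first kind, `Ψ_n = ∑_{k=0}^{n-1} (-1)^k r_{(1^k, n-k)}`. -/
noncomputable def psi (n : ℕ) : NSym :=
  ∑ k : Fin n, (-1 : ℚ) ^ (k : ℕ) • ribbon (hookComp n k k.2)

/-! ### Standard reverse composition tableaux

Rows are numbered from top to bottom and columns from left to right, both starting at `0`.
A filling of the boxes of `α` is a function `τ : ℕ → ℕ → ℕ`, `τ i j` being the entry in row `i` and
column `j`, that vanishes outside the diagram of `α`. -/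

/-- The reverse composition diagram of `α`: row `i` has `α i` boxes. -/
def diagram (α : List ℕ+) : Set (ℕ × ℕ) :=
  {p | ∃ h : p.1 < α.length, p.2 < (α[p.1] : ℕ)}

/-- Semistandard reverse composition tableaux of (straight) shape `α`. -/
structure IsSSRCT (α : List ℕ+) (τ : ℕ → ℕ → ℕ) : Prop where
  zeros : ∀ i j, (i, j) ∉ diagram α → τ i j = 0
  pos : ∀ i j, (i, j) ∈ diagram α → 0 < τ i j
  row_weak : ∀ i j j', j < j' → (i, j') ∈ diagram α → τ i j' ≤ τ i j
  col_strict : ∀ i i', i < i' → (i', 0) ∈ diagram α → τ i 0 < τ i' 0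
  triple : ∀ i j k, i < j → (i, k) ∈ diagram α → (j, k + 1) ∈ diagram α → τ j (k + 1) ≤ τ i k →
    (i, k + 1) ∈ diagram α ∧ τ j (k + 1) < τ i (k + 1)

/-- Standard reverse composition tableaux of shape `α`: every element of `{1, …, |α|}` occurs
exactly once. -/
structure IsSRCT (α : List ℕ+) (τ : ℕ → ℕ → ℕ) : Prop extends IsSSRCT α τ where
  standard : Set.BijOn (fun p : ℕ × ℕ => τ p.1 p.2) (diagram α) (Set.Icc 1 (size α))

/-- The descent set: all `v` such that `v + 1` lies weakly to the right of `v`. -/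
def descentSet (α : List ℕ+) (τ : ℕ → ℕ → ℕ) : Set ℕ :=
  {v | ∃ i j i' j', (i, j) ∈ diagram α ∧ (i', j') ∈ diagram α ∧
    τ i j = v ∧ τ i' j' = v + 1 ∧ j ≤ j'}

/-- The number `d_{α,β}` of standard reverse composition tableaux of shape `α` and descent
composition `β`, i.e. whose descent set is `set(β)` (here `|α| = |β|`). -/
noncomputable def numSRCT (α β : List ℕ+) : ℕ :=
  {τ | IsSRCT α τ ∧ descentSet α τ = partialSums β}.ncard

/-- The matrix `(d_{α,β})` with `α, β` ranging over the compositions of `n`. -/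
noncomputable def dMatrix (n : ℕ) : Matrix (CompOf n) (CompOf n) ℚ :=
  fun α β => numSRCT α.1 β.1

/-- The noncommutative Schur function `s_α`. The family `(s_α)` is defined implicitly by
`r_β = ∑_{|α| = |β|} d_{α,β} s_α`; see `ribbon_eq_sum_ncSchur` and `ncSchur_unique`. -/
noncomputable def ncSchur (α : List ℕ+) : NSym :=
  ∑ β : CompOf (size α), (dMatrix (size α))⁻¹ β ⟨α, rfl⟩ • ribbon β.1

/-! The matrix `(d_{α,β})` is invertible, so that the implicit relation has exactly one solution. -/

@[simp] lemma size_nil : size [] = 0 := rfl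

@[simp] lemma size_append (α β : List ℕ+) : size (α ++ β) = size α + size β := by
  simp [size]

@[simp] lemma size_singleton (a : ℕ+) : size [a] = a := by simp [size]

@[simp] lemma size_cons (a : ℕ+) (α : List ℕ+) : size (a :: α) = a + size α := by simp [size]

lemma size_take_succ {α : List ℕ+} {i : ℕ} (h : i < α.length) :
    size (α.take (i + 1)) = size (α.take i) + α[i] := by
  rw [List.take_succ_eq_append_getElem h, size_append, size_singleton]

lemma size_take_mono (α : List ℕ+) {i j : ℕ} (h : i ≤ j) :
    size (α.take i) ≤ size (α.take j) := by
  obtain ⟨t, ht⟩ := List.take_prefix_take_left h (l := α)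
  rw [← ht]; simp

lemma size_take_le (α : List ℕ+) (i : ℕ) : size (α.take i) ≤ size α := by
  have h := congrArg size (List.take_append_drop i α)
  rw [size_append] at h
  omega

/-- If `β = β' ++ y :: s`, then no number strictly between `|β'|` and `|β'| + y` lies in
`set(β)`. -/
lemma notMem_partialSums {β' s : List ℕ+} {y : ℕ+} {v : ℕ} (h1 : size β' < v)
    (h2 : v < size β' + y) : v ∉ partialSums (β' ++ y :: s) := by
  rintro ⟨m, hm0, hm, rfl⟩
  rcases le_or_gt m β'.length with h | h
  · have := size_take_mono (β' ++ y :: s) h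
    simp at this
    omega
  · have := size_take_mono (β' ++ y :: s) (Nat.succ_le_of_lt h)
    rw [size_take_succ (by simp)] at this
    simp at this
    omega

lemma mem_diagram {α : List ℕ+} {i j : ℕ} :
    (i, j) ∈ diagram α ↔ ∃ h : i < α.length, j < (α[i] : ℕ) := Iff.rfl

lemma IsSRCT.inj {α : List ℕ+} {τ : ℕ → ℕ → ℕ} (hτ : IsSRCT α τ) {i j i' j' : ℕ}
    (h : (i, j) ∈ diagram α) (h' : (i', j') ∈ diagram α) (e : τ i j = τ i' j') :
    i = i' ∧ j = j' := by
  have := hτ.standard.injOn h h' e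
  simpa using this

lemma IsSRCT.surj {α : List ℕ+} {τ : ℕ → ℕ → ℕ} (hτ : IsSRCT α τ) {v : ℕ} (h0 : 0 < v)
    (h : v ≤ size α) : ∃ i j, (i, j) ∈ diagram α ∧ τ i j = v := by
  obtain ⟨⟨i, j⟩, h1, h2⟩ := hτ.standard.surjOn ⟨h0, h⟩
  exact ⟨i, j, h1, h2⟩

lemma diagram_left {α : List ℕ+} {i j j' : ℕ} (h : (i, j') ∈ diagram α) (hj : j ≤ j') :
    (i, j) ∈ diagram α := by
  obtain ⟨h1, h2⟩ := h
  exact ⟨h1, lt_of_le_of_lt hj h2⟩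

/-- One row of the comparison between a tableau and its descent composition. -/
lemma row_canonical {α' β' s : List ℕ+} {x y : ℕ+} {τ : ℕ → ℕ → ℕ}
    (hτ : IsSRCT (α' ++ x :: s) τ)
    (hd : descentSet (α' ++ x :: s) τ = partialSums (β' ++ y :: s))
    (hs : size α' + x = size β' + y)
    (hle : ∀ i j, (i, j) ∈ diagram (α' ++ x :: s) → (i ≤ α'.length ↔ τ i j ≤ size α' + x)) :
    ∀ j, j < (y : ℕ) →
      (α'.length, j) ∈ diagram (α' ++ x :: s) ∧ τ α'.length j = size α' + x - j := by
  have hx := x.pos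
  have hy := y.pos
  intro j
  induction j using Nat.strong_induction_on with
  | _ j ih =>
  intro hj
  obtain ⟨i, c, hic, hv⟩ := hτ.surj (v := size α' + x - j) (by omega) (by simp; omega)
  have hi : i ≤ α'.length := (hle i c hic).2 (by omega)
  -- the entry is in column at least `j`
  have hjc : j ≤ c := by
    rcases Nat.eq_zero_or_pos j with rfl | hj0
    · exact Nat.zero_le _
    · by_contra hcj
      obtain ⟨h1, h2⟩ := ih (j - 1) (by omega) (by omega)
      have hnot := notMem_partialSums (β' := β') (s := s) (y := y) (v := size α' + x - j)
        (by omega) (by omega)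
      rw [← hd] at hnot
      exact hnot ⟨i, c, _, _, hic, h1, hv, by omega, by omega⟩
  -- it is in column `j` exactly
  have hcj : c = j := by
    by_contra hne
    have hc : 0 < c := by omega
    have hleft := diagram_left hic (Nat.sub_le c 1)
    have h1 := hτ.row_weak i (c - 1) c (by omega) hic
    have h2 := (hle _ _ hleft).1 hi
    have h3 : τ i (c - 1) ≠ τ i c := fun e => by
      have := (hτ.inj hleft hic e).2
      omega
    obtain ⟨h4, h5⟩ := ih (size α' + x - τ i (c - 1)) (by omega) (by omega)
    have := (hτ.inj hleft h4 (by omega)).2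
    omega
  subst hcj
  have hir : i = α'.length := by
    rcases Nat.eq_zero_or_pos c with rfl | hc
    · by_contra hne
      have hmem : (α'.length, 0) ∈ diagram (α' ++ x :: s) := ⟨by simp, by simp⟩
      have h1 := hτ.col_strict i α'.length (by omega) hmem
      have h2 := (hle _ _ hmem).1 le_rfl
      omega
    · have hleft := diagram_left hic (Nat.sub_le c 1)
      have h1 := hτ.row_weak i (c - 1) c (by omega) hic
      have h2 := (hle _ _ hleft).1 hi
      have h3 : τ i (c - 1) ≠ τ i c := fun e => by
        have := (hτ.inj hleft hic e).2
        omega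
      obtain ⟨h4, h5⟩ := ih (size α' + x - τ i (c - 1)) (by omega) (by omega)
      exact (hτ.inj hleft h4 (by omega)).1
  subst hir
  exact ⟨hic, hv⟩

/-- If `α` and the descent composition agree on a suffix, the corresponding rows are filled in
the canonical way. -/
lemma suffix_canonical (s : List ℕ+) : ∀ (α' β' : List ℕ+) (τ : ℕ → ℕ → ℕ),
    IsSRCT (α' ++ s) τ → descentSet (α' ++ s) τ = partialSums (β' ++ s) → size α' = size β' →
    (∀ i j, (i, j) ∈ diagram (α' ++ s) → (i < α'.length ↔ τ i j ≤ size α')) ∧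
    (∀ i j, (i, j) ∈ diagram (α' ++ s) → α'.length ≤ i →
      τ i j = size ((α' ++ s).take (i + 1)) - j) := by
  induction s with
  | nil =>
    intro α' β' τ hτ _ _
    constructor
    · intro i j h
      have h1 := (hτ.standard.mapsTo h).2
      have h2 := h.1
      simp at h1 h2
      exact ⟨fun _ => h1, fun _ => h2⟩
    · intro i j h h3
      have h2 := h.1
      simp at h2
      omega
  | cons x s ih =>
    intro α' β' τ hτ hd hs
    obtain ⟨ih1, ih2⟩ := ih (α' ++ [x]) (β' ++ [x]) τ (by simpa using hτ) (by simpa using hd)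
      (by simp [hs])
    simp only [List.append_assoc, List.singleton_append, List.length_append, List.length_singleton,
      size_append, size_singleton, Nat.lt_succ_iff] at ih1 ih2
    have key := row_canonical hτ hd (by omega) ih1
    have hrow : ∀ j, (α'.length, j) ∈ diagram (α' ++ x :: s) → j < (x : ℕ) := by
      rintro j ⟨h1, h2⟩
      simpa using h2
    constructor
    · intro i j h
      constructor
      · intro hi
        by_contra hgt
        have h1 := (ih1 i j h).1 hi.le
        obtain ⟨h4, h5⟩ := key (size α' + x - τ i j) (by omega)
        have := (hτ.inj h h4 (by omega)).1
        omega
      · intro hle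
        have h1 := (ih1 i j h).2 (by omega)
        rcases h1.lt_or_eq with h2 | rfl
        · exact h2
        · have h3 := hrow j h
          have h4 := (key j h3).2
          omega
    · intro i j h hi
      rcases hi.lt_or_eq with h1 | rfl
      · exact ih2 i j h h1
      · rw [(key j (hrow j h)).2, size_take_succ (by simp)]
        simp

lemma numSRCT_eq_zero {α' β' s : List ℕ+} {x y : ℕ+} (hs : size α' + x = size β' + y)
    (hxy : x < y) : numSRCT (α' ++ x :: s) (β' ++ y :: s) = 0 := by
  have : {τ | IsSRCT (α' ++ x :: s) τ ∧
      descentSet (α' ++ x :: s) τ = partialSums (β' ++ y :: s)} = ∅ := by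
    refine Set.eq_empty_of_forall_notMem ?_
    rintro τ ⟨hτ, hd⟩
    have h1 := (suffix_canonical s (α' ++ [x]) (β' ++ [y]) τ (by simpa using hτ)
      (by simpa using hd) (by simp [hs])).1
    simp only [List.append_assoc, List.singleton_append, List.length_append, List.length_singleton,
      size_append, size_singleton, Nat.lt_succ_iff] at h1
    obtain ⟨h2, h3⟩ := (row_canonical hτ hd hs h1 x hxy).1
    simp at h3
  rw [numSRCT, this, Set.ncard_empty]

open Classical in
/-- The canonical tableau of shape `α`: the numbers `1, …, |α|` are written row by row, from top to
bottom, and from right to left in each row. -/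
noncomputable def canonicalSRCT (α : List ℕ+) (i j : ℕ) : ℕ :=
  if (i, j) ∈ diagram α then size (α.take (i + 1)) - j else 0

lemma canonicalSRCT_bounds {α : List ℕ+} {i j : ℕ} (h : (i, j) ∈ diagram α) :
    canonicalSRCT α i j + j = size (α.take (i + 1)) ∧ size (α.take i) < canonicalSRCT α i j := by
  obtain ⟨h1, h2⟩ := id h
  dsimp only at h1 h2
  have h3 := size_take_succ h1
  rw [canonicalSRCT, if_pos h]
  omega

lemma canonicalSRCT_lt {α : List ℕ+} {i j i' j' : ℕ} (h : (i, j) ∈ diagram α)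
    (h' : (i', j') ∈ diagram α) (hi : i < i') :
    canonicalSRCT α i j < canonicalSRCT α i' j' := by
  have h1 := canonicalSRCT_bounds h
  have h2 := canonicalSRCT_bounds h'
  have h3 := size_take_mono α (Nat.succ_le_of_lt hi)
  simp only [Nat.succ_eq_add_one] at h3
  omega

lemma isSRCT_canonicalSRCT (α : List ℕ+) : IsSRCT α (canonicalSRCT α) where
  zeros i j h := by rw [canonicalSRCT, if_neg h]
  pos i j h := (Nat.zero_le _).trans_lt (canonicalSRCT_bounds h).2
  row_weak i j j' hj h := by
    have h1 := canonicalSRCT_bounds h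
    have h2 := canonicalSRCT_bounds (diagram_left h hj.le)
    omega
  col_strict i i' hi h := canonicalSRCT_lt ⟨hi.trans h.1, PNat.pos _⟩ h hi
  triple i j k hij h h' hle := absurd (canonicalSRCT_lt h h' hij) (by omega)
  standard := by
    refine ⟨?_, ?_, ?_⟩
    · rintro ⟨i, j⟩ h
      have h1 := canonicalSRCT_bounds h
      have h2 := size_take_le α (i + 1)
      exact ⟨by dsimp only; omega, by dsimp only; omega⟩
    · rintro ⟨i, j⟩ h ⟨i', j'⟩ h' e
      dsimp only at e
      have h1 := canonicalSRCT_bounds h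
      have h2 := canonicalSRCT_bounds h'
      rcases lt_trichotomy i i' with hi | rfl | hi
      · have := canonicalSRCT_lt h h' hi
        omega
      · have : j = j' := by omega
        rw [this]
      · have := canonicalSRCT_lt h' h hi
        omega
    · rintro v ⟨hv1, hv2⟩
      have hex : ∃ i, v ≤ size (α.take i) := ⟨α.length, by simpa using hv2⟩
      classical
      obtain ⟨i, hi⟩ : ∃ i, Nat.find hex = i + 1 := by
        refine Nat.exists_eq_succ_of_ne_zero fun h0 => ?_
        have := Nat.find_spec hex
        rw [h0] at this
        simp at this
        omega
      have h1 := Nat.find_spec hex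
      have h2 : ¬ v ≤ size (α.take i) := Nat.find_min hex (by omega)
      rw [hi] at h1
      have hlt : i < α.length := by
        by_contra hge
        rw [List.take_of_length_le (by omega)] at h2
        omega
      have h3 := size_take_succ hlt
      have hmem : (i, size (α.take (i + 1)) - v) ∈ diagram α := ⟨hlt, by dsimp only; omega⟩
      refine ⟨_, hmem, ?_⟩
      have h4 := canonicalSRCT_bounds hmem
      dsimp only
      omega

lemma descentSet_canonicalSRCT (α : List ℕ+) :
    descentSet α (canonicalSRCT α) = partialSums α := by
  ext v
  constructor
  · rintro ⟨i, j, i', j', h, h', e, e', hj⟩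
    have h1 := canonicalSRCT_bounds h
    have h2 := canonicalSRCT_bounds h'
    have hi : i < i' := by
      by_contra hge
      rcases (not_lt.1 hge).lt_or_eq with hi | rfl
      · have := canonicalSRCT_lt h' h hi
        omega
      · omega
    have h3 := size_take_mono α (Nat.succ_le_of_lt hi)
    simp only [Nat.succ_eq_add_one] at h3
    refine ⟨i + 1, Nat.succ_pos _, lt_of_le_of_lt hi h'.1, ?_⟩
    omega
  · rintro ⟨m, hm0, hm, rfl⟩
    obtain ⟨m, rfl⟩ : ∃ k, m = k + 1 := ⟨m - 1, by omega⟩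
    have hp := (α[m + 1]).pos
    have h : (m, 0) ∈ diagram α := ⟨by dsimp only; omega, PNat.pos _⟩
    have h' : (m + 1, (α[m + 1] : ℕ) - 1) ∈ diagram α := ⟨hm, by dsimp only; omega⟩
    have h1 := canonicalSRCT_bounds h
    have h2 := canonicalSRCT_bounds h'
    have h3 := size_take_succ hm
    exact ⟨m, 0, m + 1, _, h, h', by omega, by omega, Nat.zero_le _⟩

lemma numSRCT_self (α : List ℕ+) : numSRCT α α = 1 := by
  rw [numSRCT, Set.ncard_eq_one]
  refine ⟨canonicalSRCT α, Set.eq_singleton_iff_unique_mem.2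
    ⟨⟨isSRCT_canonicalSRCT α, descentSet_canonicalSRCT α⟩, ?_⟩⟩
  rintro τ ⟨hτ, hd⟩
  funext i j
  by_cases h : (i, j) ∈ diagram α
  · rw [canonicalSRCT, if_pos h]
    exact (suffix_canonical α [] [] τ hτ hd rfl).2 i j h (Nat.zero_le _)
  · rw [hτ.zeros i j h, canonicalSRCT, if_neg h]

/-- Two distinct compositions of the same size differ first, read from the right, in some part. -/
lemma exists_suffix {α β : List ℕ+} (hs : size α = size β) (h : α.reverse < β.reverse) :
    ∃ (α' β' s : List ℕ+) (x y : ℕ+), α = α' ++ x :: s ∧ β = β' ++ y :: s ∧ x < y := by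
  have aux : ∀ a b : List ℕ+, size a = size b → a < b →
      ∃ (s a' b' : List ℕ+) (x y : ℕ+), a = s ++ x :: a' ∧ b = s ++ y :: b' ∧ x < y := by
    intro a b hab hlt
    induction hlt with
    | nil =>
      rename_i y l
      have := y.pos
      simp at hab
      omega
    | rel h => exact ⟨[], _, _, _, _, rfl, rfl, h⟩
    | cons _ ih =>
      obtain ⟨s, a', b', x, y, h1, h2, h3⟩ := ih (by simpa using hab)
      exact ⟨_ :: s, a', b', x, y, by rw [h1]; rfl, by rw [h2]; rfl, h3⟩
  have hrev : ∀ l : List ℕ+, size l.reverse = size l := fun l => by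
    simp [size, List.sum_reverse]
  obtain ⟨s, a', b', x, y, h1, h2, h3⟩ := aux _ _ (by rw [hrev, hrev, hs]) h
  refine ⟨a'.reverse, b'.reverse, s.reverse, x, y, ?_, ?_, h3⟩
  · rw [← List.reverse_reverse α, h1]; simp
  · rw [← List.reverse_reverse β, h2]; simp

lemma det_dMatrix (n : ℕ) : (dMatrix n).det = 1 := by
  let ord : LinearOrder (CompOf n) := LinearOrder.lift' (fun α => α.1.reverse)
    (fun α β h => Subtype.ext (List.reverse_injective h))
  have ht : @Matrix.IsLowerTriangular _ _ _ ord.toLT (dMatrix n) := by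
    intro α β hlt
    have hlt' : α.1.reverse < β.1.reverse := hlt
    have hs : size α.1 = size β.1 := by rw [α.2, β.2]
    obtain ⟨α', β', s, x, y, h1, h2, h3⟩ := exists_suffix hs hlt'
    rw [h1, h2] at hs
    simp only [size_append, size_cons] at hs
    rw [dMatrix, h1, h2, numSRCT_eq_zero (by omega) h3, Nat.cast_zero]
  rw [Matrix.det_of_isLowerTriangular _ ht]
  simp only [dMatrix, numSRCT_self, Nat.cast_one, Finset.prod_const_one]

/-- The family `(s_α)` satisfies its defining relation. -/
theorem ribbon_eq_sum_ncSchur (β : List ℕ+) :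
    ribbon β = ∑ α : CompOf (size β), numSRCT α.1 β • ncSchur α.1 := by
  obtain ⟨n, hn⟩ : ∃ n, size β = n := ⟨_, rfl⟩
  have hdet : IsUnit (dMatrix n).det := by rw [det_dMatrix]; exact isUnit_one
  have hS : ∀ α : CompOf n, ncSchur α.1 = ∑ γ : CompOf n, (dMatrix n)⁻¹ γ α • ribbon γ.1 := by
    rintro ⟨α, rfl⟩; rfl
  subst hn
  calc ribbon β
      = ∑ γ : CompOf (size β), (1 : Matrix (CompOf (size β)) (CompOf (size β)) ℚ) γ ⟨β, rfl⟩ • ribbon γ.1 := by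
        simp [Matrix.one_apply]
    _ = ∑ γ : CompOf (size β), ∑ α : CompOf (size β),
          (dMatrix (size β) α ⟨β, rfl⟩ * (dMatrix (size β))⁻¹ γ α) • ribbon γ.1 := by
        rw [← Matrix.nonsing_inv_mul _ hdet]
        refine Finset.sum_congr rfl fun γ _ => ?_
        rw [Matrix.mul_apply, Finset.sum_smul]
        exact Finset.sum_congr rfl fun α _ => by rw [mul_comm]
    _ = _ := by
        rw [Finset.sum_comm]
        refine Finset.sum_congr rfl fun α _ => ?_
        rw [hS, Finset.smul_sum]
        refine Finset.sum_congr rfl fun γ _ => ?_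
        rw [mul_smul, dMatrix, Nat.cast_smul_eq_nsmul]

/-- The family `(s_α)` is the only solution of its defining relation. -/
theorem ncSchur_unique (S : List ℕ+ → NSym)
    (hS : ∀ β, ribbon β = ∑ α : CompOf (size β), numSRCT α.1 β • S α.1) : S = ncSchur := by
  funext α
  have hdet : IsUnit (dMatrix (size α)).det := by rw [det_dMatrix]; exact isUnit_one
  have hS' : ∀ β : CompOf (size α),
      ribbon β.1 = ∑ γ : CompOf (size α), dMatrix (size α) γ β • S γ.1 := by
    rintro ⟨β, hβ⟩
    have h := hS β
    rw [hβ] at h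
    simpa only [dMatrix, Nat.cast_smul_eq_nsmul] using h
  calc S α = ∑ γ : CompOf (size α), (1 : Matrix (CompOf (size α)) (CompOf (size α)) ℚ) γ ⟨α, rfl⟩ • S γ.1 := by
        simp [Matrix.one_apply]
    _ = ∑ γ : CompOf (size α), ∑ β : CompOf (size α),
          ((dMatrix (size α))⁻¹ β ⟨α, rfl⟩ * dMatrix (size α) γ β) • S γ.1 := by
        rw [← Matrix.mul_nonsing_inv _ hdet]
        refine Finset.sum_congr rfl fun γ _ => ?_
        rw [Matrix.mul_apply, Finset.sum_smul]
        exact Finset.sum_congr rfl fun β _ => by rw [mul_comm]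
    _ = ncSchur α := by
        rw [Finset.sum_comm, ncSchur]
        refine Finset.sum_congr rfl fun β _ => ?_
        rw [hS', Finset.smul_sum]
        exact Finset.sum_congr rfl fun γ _ => by rw [mul_smul]

/-! ### Box-adding operators -/

/-- `CoverInColumn i α β`: the composition `β` covers `α` in the reverse composition poset, and the
added box is in the `i`-th column (columns being numbered from `1`). Either a part `1` is put in
front, or the leftmost part equal to some `j` is replaced by `j + 1`. -/
inductive CoverInColumn : ℕ+ → List ℕ+ → List ℕ+ → Prop
  | new (α : List ℕ+) : CoverInColumn 1 α (1 :: α)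
  | extend (p s : List ℕ+) (j : ℕ+) (h : j ∉ p) :
      CoverInColumn (j + 1) (p ++ j :: s) (p ++ (j + 1) :: s)

/-- Replaces the leftmost part `j` with `j + 1` such that `j + 1 = i`, if there is one. -/
def extendPart (i : ℕ+) : List ℕ+ → Option (List ℕ+)
  | [] => none
  | a :: l => if a + 1 = i then some (i :: l) else (extendPart i l).map (fun l' => a :: l')

/-- The box-adding operator `𝔱_i`, with `none` in the role of `0`. -/
def boxAdd (i : ℕ+) (α : List ℕ+) : Option (List ℕ+) :=
  if i = 1 then some (1 :: α) else extendPart i α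

lemma extendPart_eq_some_iff (i : ℕ+) (α β : List ℕ+) : extendPart i α = some β ↔
    ∃ (p s : List ℕ+) (j : ℕ+), j ∉ p ∧ i = j + 1 ∧ α = p ++ j :: s ∧ β = p ++ (j + 1) :: s := by
  induction α generalizing β with
  | nil => simp [extendPart]
  | cons a l ih =>
    rw [extendPart]
    split_ifs with h
    · subst h
      constructor
      · intro h
        simp only [Option.some.injEq] at h
        exact ⟨[], l, a, by simp, rfl, rfl, h.symm⟩
      · rintro ⟨p, s, j, hj, hi, h1, rfl⟩
        have haj : a = j := add_right_cancel hi
        subst haj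
        cases p with
        | nil => simp at h1; simp [h1]
        | cons b p => simp at h1 hj; exact absurd h1.1 hj.1
    · simp only [Option.map_eq_some_iff, ih]
      constructor
      · rintro ⟨_, ⟨p, s, j, hj, rfl, rfl, rfl⟩, rfl⟩
        refine ⟨a :: p, s, j, ?_, rfl, rfl, rfl⟩
        simp only [List.mem_cons, not_or]
        exact ⟨fun e => h (by rw [e]), hj⟩
      · rintro ⟨p, s, j, hj, rfl, h1, rfl⟩
        cases p with
        | nil => simp at h1; exact absurd (by rw [h1.1]) h
        | cons b p =>
          simp only [List.cons_append, List.cons.injEq] at h1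
          obtain ⟨rfl, rfl⟩ := h1
          simp only [List.mem_cons, not_or] at hj
          exact ⟨_, ⟨p, s, j, hj.2, rfl, rfl, rfl⟩, rfl⟩

/-- `𝔱_i(α) = β` if and only if `β` covers `α` and the added box is in column `i`. -/
theorem boxAdd_eq_some_iff (i : ℕ+) (α β : List ℕ+) :
    boxAdd i α = some β ↔ CoverInColumn i α β := by
  rw [boxAdd]
  split_ifs with h
  · subst h
    constructor
    · intro h
      simp only [Option.some.injEq] at h
      exact h ▸ CoverInColumn.new α
    · intro h
      generalize hi : (1 : ℕ+) = i at h
      cases h with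
      | new => rfl
      | extend p s j _ => exact absurd hi (PNat.lt_add_left 1 j).ne
  · rw [extendPart_eq_some_iff]
    constructor
    · rintro ⟨p, s, j, hj, rfl, rfl, rfl⟩
      exact CoverInColumn.extend p s j hj
    · intro h'
      cases h' with
      | new => exact absurd rfl h
      | extend p s j hj => exact ⟨p, s, j, hj, rfl, rfl, rfl⟩

/-- The action of the word `w = 𝔱_{i₁} ⋯ 𝔱_{iₙ}`, given as the list `[i₁, …, iₙ]`; the rightmost
letter acts first. -/
def wordAct (w : List ℕ+) (α : List ℕ+) : Option (List ℕ+) :=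
  w.foldr (fun i o => o.bind (boxAdd i)) (some α)

/-- The element of `NSym` named by a composition or `0`: `α ↦ s_α` and `0 ↦ 0`. -/
noncomputable def toNSym (o : Option (List ℕ+)) : NSym := o.elim 0 ncSchur

/-! ### Reverse hookwords -/

/-- `RHW_{n,k}`: words of length `n` with `i₁ ≤ ⋯ ≤ i_{k+1} > i_{k+2} > ⋯ > iₙ`, where
`0 ≤ k ≤ n - 1`. -/
def RHWk (n k : ℕ) : Set (List ℕ+) :=
  {w | w.length = n ∧ k < n ∧ (w.take (k + 1)).Pairwise (· ≤ ·) ∧ (w.drop k).Pairwise (· > ·)}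

/-- `RHW_n`: reverse hookwords of length `n`. -/
def RHW (n : ℕ) : Set (List ℕ+) := {w | ∃ k, w ∈ RHWk n k}

/-- A word is connected if the set of its indices is an interval. -/
def WordConnected (w : List ℕ+) : Prop := {i | i ∈ w}.OrdConnected

/-- `CRHW_n`: connected reverse hookwords of length `n`. -/
def CRHW (n : ℕ) : Set (List ℕ+) := {w | w ∈ RHW n ∧ WordConnected w}

/-- `asc(w) = |arm(w)| - 1`, which is the number `k` such that `w` is a reverse `k`-hookword; see
`asc_eq`. -/
noncomputable def asc (w : List ℕ+) : ℕ := sInf {k | w ∈ RHWk w.length k}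

lemma RHWk_unique {n k l : ℕ} {w : List ℕ+} (hk : w ∈ RHWk n k) (hl : w ∈ RHWk n l) : k = l := by
  have aux : ∀ {k l : ℕ}, w ∈ RHWk n k → w ∈ RHWk n l → ¬ k < l := by
    rintro k l ⟨h1, h2, h3, h4⟩ ⟨-, h6, h7, h8⟩ hlt
    have ha := List.pairwise_iff_getElem.1 h7 k (k + 1) (by simp; omega) (by simp; omega) (by omega)
    have hb := List.pairwise_iff_getElem.1 h4 0 1 (by simp; omega) (by simp; omega) (by omega)
    simp only [List.getElem_take, List.getElem_drop, Nat.add_zero] at ha hb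
    exact absurd ha (not_le.2 hb)
  have h1 := aux hk hl
  have h2 := aux hl hk
  omega

theorem asc_eq {n k : ℕ} {w : List ℕ+} (h : w ∈ RHWk n k) : asc w = k := by
  have hn : w.length = n := h.1
  have : {l | w ∈ RHWk w.length l} = {k} := by
    ext l
    rw [hn]
    exact ⟨fun hl => RHWk_unique hl h, fun hl => by rw [Set.mem_singleton_iff.1 hl]; exact h⟩
  rw [asc, this, csInf_singleton]

end NSymMN

/-!
Let `T_i` be the linear operator induced by `𝔱_i` on the free module over compositions. For a
composition `β` let `R_β` be the sum of all words in the `T_i` whose descent set (the positions `v`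
with `i_v ≤ i_{v + 1}`) is `set(β)`. Concatenating a strictly decreasing word of length `a` with a
word of descent composition `(b, γ)` gives a word of descent composition `(a, b, γ)` or
`(a + b, γ)`, so `R_a R_{(b, γ)} = R_{(a, b, γ)} + R_{(a + b, γ)}`. The ribbons satisfy the same
product rule (`ι_mul_ribbon`). Since `NSym` is free on the `h_a`, it acts on the free module with
`h_a ↦ R_a`, and then `r_β` acts as `R_β` (`wordHom_ribbon`).

Reading off the columns of the entries `1, 2, …` of a standard reverse composition tableau of shape
`γ` gives a bijection onto the words that build `γ` from the empty composition, and it preserves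
descents (`numSRCT_eq_ncard_words`). Hence `r_β` sends the basis vector `e_∅` to
`∑ d_{γ,β} e_γ`. By the relation defining `s_γ`, an element `x` of `NSym` sends `e_∅` to a vector
that becomes `x` under the map `S : e_γ ↦ s_γ`, and `s_α` sends `e_∅` to `e_α`. Therefore `x e_α =
(x s_α) e_∅`, which `S` maps to `x s_α`: the action is left multiplication
(`ribbon_mul_ncSchur`). As reverse `k`-hookwords are the words with descent set `{1, …, k}`, the
formula for the hook ribbons is a special case. To have finite sums, the letters are bounded
by `N`; a word of length `n` that does not kill `α` has all letters at most `|α| + n`.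

For `Ψ_n`, the disconnected reverse hookwords have to cancel. If the letter `c` is missing in such a
word `w`, while smaller and greater letters occur, then the greater letters form a block `u`,
placed between an arm and a leg of smaller letters. The largest of the smaller letters has an
occurrence next to `u`, which can be moved to the other side of `u`. This is a sign-reversing
involution, and it does not change the action of `w`, because `T_i` and `T_j` commute for
`|i - j| ≥ 2` (`sum_not_wordConnected_eq_zero`).
-/

namespace NSymMN

/-! ### The recursion for ribbons -/

lemma Coarser.size_eq {α β : List ℕ+} (h : Coarser α β) : size α = size β := by
  obtain ⟨L, rfl, h⟩ := h
  rw [size, ← h]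
  clear h
  induction L with
  | nil => rfl
  | cons x L ih => simp [ih]

lemma coarser_nil_iff {α : List ℕ+} : Coarser α [] ↔ α = [] := by
  constructor
  · intro h
    have := h.size_eq
    cases α with
    | nil => rfl
    | cons a l =>
      have := a.pos
      simp at *
  · rintro rfl
    exact ⟨[], rfl, rfl⟩

lemma Coarser.length_le {α β : List ℕ+} (h : Coarser α β) : α.length ≤ β.length := by
  obtain ⟨L, rfl, h⟩ := h
  induction L generalizing α with
  | nil => simp at h; simp [h]
  | cons x L ih =>
    cases α with
    | nil => simp
    | cons a α =>
      simp only [List.map_cons, List.cons.injEq] at h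
      have := ih h.2
      have hx : x ≠ [] := by
        rintro rfl
        have := a.pos
        simp at h
        omega
      have := List.length_pos_iff.2 hx
      simp only [List.length_cons, List.flatten_cons, List.length_append]
      omega

lemma coarser_cons_iff {α γ : List ℕ+} {a : ℕ+} : Coarser α (a :: γ) ↔
    ∃ x L c α', α = c :: α' ∧ x ++ L = γ ∧ (c : ℕ) = a + size x ∧ Coarser α' L := by
  constructor
  · rintro ⟨L, h1, h2⟩
    cases L with
    | nil => simp at h1
    | cons x L =>
      cases α with
      | nil => simp at h2
      | cons c α =>
        simp only [List.map_cons, List.cons.injEq] at h2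
        cases x with
        | nil =>
          have := c.pos
          simp at h2
          omega
        | cons b x =>
          simp only [List.flatten_cons, List.cons_append, List.cons.injEq] at h1
          obtain ⟨rfl, rfl⟩ := h1
          exact ⟨x, L.flatten, c, α, rfl, rfl, by rw [← h2.1, size_cons], L, rfl, h2.2⟩
  · rintro ⟨x, _, c, α', rfl, rfl, hc, L, rfl, h⟩
    exact ⟨(a :: x) :: L, by simp, by simp [h, hc]⟩

lemma coarser_singleton_iff {α : List ℕ+} {a : ℕ+} : Coarser α [a] ↔ α = [a] := by
  rw [coarser_cons_iff]
  constructor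
  · rintro ⟨x, L, c, α', rfl, hx, hc, h⟩
    obtain ⟨rfl, rfl⟩ := List.append_eq_nil_iff.1 hx
    rw [coarser_nil_iff] at h
    rw [size_nil, add_zero, PNat.coe_inj] at hc
    rw [h, hc]
  · rintro rfl
    exact ⟨[], [], a, [], rfl, rfl, rfl, coarser_nil_iff.2 rfl⟩

lemma coarser_cons_cons_iff {α γ : List ℕ+} {a b : ℕ+} : Coarser α (a :: b :: γ) ↔
    (∃ α', Coarser α' (b :: γ) ∧ a :: α' = α) ∨ Coarser α ((a + b) :: γ) := by
  rw [coarser_cons_iff, coarser_cons_iff (γ := γ)]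
  constructor
  · rintro ⟨x, L, c, α', rfl, hx, hc, h⟩
    cases x with
    | nil =>
      rw [size_nil, add_zero, PNat.coe_inj] at hc
      rw [List.nil_append] at hx
      subst hx hc
      exact Or.inl ⟨α', h, rfl⟩
    | cons d x =>
      simp only [List.cons_append, List.cons.injEq] at hx
      obtain ⟨rfl, rfl⟩ := hx
      refine Or.inr ⟨x, L, c, α', rfl, rfl, ?_, h⟩
      rw [hc, size_cons, PNat.add_coe, add_assoc]
  · rintro (⟨α', h, rfl⟩ | ⟨x, L, c, α', rfl, rfl, hc, h⟩)
    · exact ⟨[], _, a, α', rfl, rfl, rfl, h⟩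
    · exact ⟨b :: x, L, c, α', rfl, rfl, by rw [hc, size_cons, PNat.add_coe, add_assoc], h⟩

/-- The compositions `α ≽ β`. -/
noncomputable def coarsenings (β : List ℕ+) : Finset (List ℕ+) :=
  Set.Finite.toFinset (s := {α | Coarser α β})
    ((Set.toFinite (Set.range (Subtype.val : CompOf (size β) → List ℕ+))).subset
      fun α h => ⟨⟨α, h.size_eq⟩, rfl⟩)

lemma mem_coarsenings {α β : List ℕ+} : α ∈ coarsenings β ↔ Coarser α β := by
  simp [coarsenings]

lemma ribbon_eq_sum (β : List ℕ+) : ribbon β =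
    ∑ α ∈ coarsenings β, (-1 : ℚ) ^ (β.length - α.length) • hprod α := by
  classical
  rw [ribbon, ← Finset.sum_filter]
  refine Finset.sum_bij (fun α _ => α.1) ?_ ?_ ?_ ?_
  · intro α h
    exact mem_coarsenings.2 (Finset.mem_filter.1 h).2
  · intro α _ α' _ h
    exact Subtype.ext h
  · intro α h
    have h := mem_coarsenings.1 h
    exact ⟨⟨α, h.size_eq⟩, by simpa using h, rfl⟩
  · intro α _
    rfl

lemma ribbon_nil : ribbon [] = 1 := by
  have : coarsenings [] = {[]} := by
    ext; simp [mem_coarsenings, coarser_nil_iff]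
  simp [ribbon_eq_sum, this, hprod]

lemma ribbon_singleton (a : ℕ+) : ribbon [a] = FreeAlgebra.ι ℚ a := by
  have : coarsenings [a] = {[a]} := by
    ext; simp [mem_coarsenings, coarser_singleton_iff]
  simp [ribbon_eq_sum, this, hprod]

/-- The product rule `h_a r_{(b, γ)} = r_{(a, b, γ)} + r_{(a + b, γ)}`. -/
lemma ι_mul_ribbon (a b : ℕ+) (γ : List ℕ+) :
    FreeAlgebra.ι ℚ a * ribbon (b :: γ) = ribbon (a :: b :: γ) + ribbon ((a + b) :: γ) := by
  classical
  have hU : coarsenings (a :: b :: γ) =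
      (coarsenings (b :: γ)).image (fun α => a :: α) ∪ coarsenings ((a + b) :: γ) := by
    ext α
    simp only [Finset.mem_union, Finset.mem_image, mem_coarsenings, coarser_cons_cons_iff]
  have hD : Disjoint ((coarsenings (b :: γ)).image (fun α => a :: α))
      (coarsenings ((a + b) :: γ)) := by
    rw [Finset.disjoint_left]
    intro α h1 h2
    simp only [Finset.mem_image, mem_coarsenings] at h1 h2
    obtain ⟨α', -, rfl⟩ := h1
    obtain ⟨x, L, c, α'', h, -, hc, -⟩ := coarser_cons_iff.1 h2
    simp only [List.cons.injEq] at h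
    have := b.pos
    rw [← h.1, PNat.add_coe] at hc
    omega
  rw [ribbon_eq_sum (a :: b :: γ), hU, Finset.sum_union hD,
    Finset.sum_image (fun _ _ _ _ h => by simpa using h), ribbon_eq_sum (b :: γ),
    ribbon_eq_sum ((a + b) :: γ), add_assoc, ← Finset.sum_add_distrib, Finset.mul_sum,
    Finset.sum_eq_zero (s := coarsenings ((a + b) :: γ)), add_zero]
  · refine Finset.sum_congr rfl fun α _ => ?_
    rw [mul_smul_comm]
    simp [hprod]
  · intro α h
    have h := (mem_coarsenings.1 h).length_le
    simp only [List.length_cons] at h ⊢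
    rw [Nat.succ_sub h, pow_succ]
    simp

/-! ### Words and their descents -/

/-- The words of length `n` in the letters `1, …, N`. -/
def words (N : ℕ+) : ℕ → Finset (List ℕ+)
  | 0 => {[]}
  | n + 1 => (Finset.Icc 1 N ×ˢ words N n).image fun p => p.1 :: p.2

lemma mem_words {N : ℕ+} {n : ℕ} {w : List ℕ+} :
    w ∈ words N n ↔ w.length = n ∧ ∀ i ∈ w, i ≤ N := by
  induction n generalizing w with
  | zero =>
    simp only [words, Finset.mem_singleton, List.length_eq_zero_iff]
    exact ⟨by rintro rfl; simp, fun h => h.1⟩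
  | succ n ih =>
    cases w with
    | nil => simp [words]
    | cons i w => simp [words, ih, and_left_comm, and_comm]

/-- The descents of a word: the positions `v` (counted from `1`) with `i_v ≤ i_{v + 1}`. -/
def wordDes (w : List ℕ+) : Set ℕ := {v | 0 < v ∧ ∃ h : v < w.length, w[v - 1] ≤ w[v]}

lemma mem_wordDes_append {u v : List ℕ+} {x : ℕ} (hu : x ≠ u.length) : x ∈ wordDes (u ++ v) ↔
    x ∈ wordDes u ∨ ∃ y ∈ wordDes v, x = u.length + y := by
  rcases lt_or_gt_of_ne hu with h | h
  · constructor
    · rintro ⟨h0, h1, h2⟩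
      rw [List.getElem_append_left h, List.getElem_append_left (by omega)] at h2
      exact Or.inl ⟨h0, h, h2⟩
    · rintro (⟨h0, h1, h2⟩ | ⟨y, -, rfl⟩)
      · refine ⟨h0, by simp; omega, ?_⟩
        rwa [List.getElem_append_left h, List.getElem_append_left (by omega)]
      · omega
  · obtain ⟨y, rfl⟩ : ∃ y, x = u.length + (y + 1) := ⟨x - u.length - 1, by omega⟩
    constructor
    · rintro ⟨h0, h1, h2⟩
      refine Or.inr ⟨y + 1, ⟨by omega, by simp at h1; omega, ?_⟩, rfl⟩
      rw [List.getElem_append_right (by omega), List.getElem_append_right (by omega)] at h2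
      convert h2 using 2 <;> omega
    · rintro (⟨h0, h1, h2⟩ | ⟨z, ⟨h0, h1, h2⟩, h3⟩)
      · omega
      · obtain rfl : y + 1 = z := by omega
        refine ⟨by omega, by simp; omega, ?_⟩
        rw [List.getElem_append_right (by omega), List.getElem_append_right (by omega)]
        convert h2 using 2 <;> omega

lemma lt_length_of_mem_wordDes {w : List ℕ+} {x : ℕ} (h : x ∈ wordDes w) : x < w.length := h.2.1

lemma pos_of_mem_partialSums {β : List ℕ+} {x : ℕ} (h : x ∈ partialSums β) : 0 < x := by
  obtain ⟨m, h0, h1, rfl⟩ := h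
  cases β with
  | nil => simp at h1
  | cons b β =>
    obtain ⟨m, rfl⟩ := Nat.exists_eq_succ_of_ne_zero h0.ne'
    have := b.pos
    simp

lemma partialSums_singleton (a : ℕ+) : partialSums [a] = ∅ := by
  refine Set.eq_empty_of_forall_notMem ?_
  rintro _ ⟨m, h0, h1, rfl⟩
  simp at h1
  omega

lemma mem_partialSums_cons_cons {a b : ℕ+} {γ : List ℕ+} {x : ℕ} :
    x ∈ partialSums (a :: b :: γ) ↔ x = a ∨ ∃ y ∈ partialSums (b :: γ), x = a + y := by
  constructor
  · rintro ⟨m, h0, h1, rfl⟩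
    obtain ⟨m, rfl⟩ := Nat.exists_eq_succ_of_ne_zero h0.ne'
    rcases Nat.eq_zero_or_pos m with rfl | hm
    · simp
    · exact Or.inr ⟨_, ⟨m, hm, by simpa using h1, rfl⟩, by simp⟩
  · rintro (rfl | ⟨_, ⟨m, h0, h1, rfl⟩, rfl⟩)
    · exact ⟨1, by simp⟩
    · exact ⟨m + 1, by omega, by simpa using h1, by simp⟩

lemma mem_partialSums_add_cons {a b : ℕ+} {γ : List ℕ+} {x : ℕ} :
    x ∈ partialSums ((a + b) :: γ) ↔ ∃ y ∈ partialSums (b :: γ), x = a + y := by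
  constructor
  · rintro ⟨m, h0, h1, rfl⟩
    refine ⟨_, ⟨m, h0, h1, rfl⟩, ?_⟩
    obtain ⟨m, rfl⟩ := Nat.exists_eq_succ_of_ne_zero h0.ne'
    simp [add_assoc]
  · rintro ⟨_, ⟨m, h0, h1, rfl⟩, rfl⟩
    refine ⟨m, h0, h1, ?_⟩
    obtain ⟨m, rfl⟩ := Nat.exists_eq_succ_of_ne_zero h0.ne'
    simp [add_assoc]

/-- Concatenating a strictly decreasing word of length `a` with a word of descent composition
`(b, γ)` gives a word of descent composition `(a, b, γ)` or `(a + b, γ)`, according to whether or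
not the junction is a descent. -/
lemma wordDes_append_iff {u v : List ℕ+} {a b : ℕ+} {γ : List ℕ+} (hu : u.length = a) :
    (wordDes u = ∅ ∧ wordDes v = partialSums (b :: γ)) ↔
    (wordDes (u ++ v) = partialSums (a :: b :: γ) ∨
      wordDes (u ++ v) = partialSums ((a + b) :: γ)) := by
  constructor
  · rintro ⟨h1, h2⟩
    have key : ∀ x : ℕ, x ≠ a →
        (x ∈ wordDes (u ++ v) ↔ ∃ y ∈ partialSums (b :: γ), x = a + y) := by
      intro x hx
      rw [mem_wordDes_append (by omega), h1, h2, hu]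
      simp
    by_cases ha : (a : ℕ) ∈ wordDes (u ++ v)
    · left
      ext x
      rw [mem_partialSums_cons_cons]
      by_cases hx : x = a
      · simp [hx, ha]
      · simp [hx, key]
    · right
      ext x
      rw [mem_partialSums_add_cons]
      by_cases hx : x = a
      · subst hx
        refine iff_of_false ha ?_
        rintro ⟨y, hy, h⟩
        have := pos_of_mem_partialSums hy
        omega
      · exact key x hx
  · intro h
    have key : ∀ x : ℕ, x ≠ a →
        (x ∈ wordDes (u ++ v) ↔ ∃ y ∈ partialSums (b :: γ), x = a + y) := by
      intro x hx
      rcases h with h | h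
      · rw [h, mem_partialSums_cons_cons]; simp [hx]
      · rw [h, mem_partialSums_add_cons]
    constructor
    · refine Set.eq_empty_of_forall_notMem fun x hx => ?_
      have hlt := lt_length_of_mem_wordDes hx
      obtain ⟨y, -, h2⟩ := (key x (by omega)).1 ((mem_wordDes_append (by omega)).2 (Or.inl hx))
      omega
    · ext y
      rcases Nat.eq_zero_or_pos y with rfl | hy
      · exact iff_of_false (fun h => absurd h.1 (by simp))
          (fun h => absurd (pos_of_mem_partialSums h) (by simp))
      · have h1 := key (a + y) (by omega)
        rw [mem_wordDes_append (by omega)] at h1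
        constructor
        · intro h2
          obtain ⟨z, hz, e⟩ := h1.1 (Or.inr ⟨y, h2, by omega⟩)
          rwa [show y = z by omega]
        · intro h2
          rcases h1.2 ⟨y, h2, rfl⟩ with h3 | ⟨z, hz, e⟩
          · have := lt_length_of_mem_wordDes h3
            omega
          · rwa [show y = z by omega]

/-! ### Ribbons as sums of words -/

section Representation

variable {A : Type*} [Ring A]

open Classical in
/-- The sum of the products `T_w` over the words `w` of length `n` in the letters `1, …, N` whose
descent set is `D`. -/
noncomputable def descentSum (T : ℕ+ → A) (N : ℕ+) (n : ℕ) (D : Set ℕ) : A :=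
  ∑ w ∈ words N n with wordDes w = D, (w.map T).prod

lemma sum_words_mul_sum_words (T : ℕ+ → A) (N : ℕ+) (a b : ℕ) (P Q : List ℕ+ → Prop)
    [DecidablePred P] [DecidablePred Q] :
    (∑ w ∈ words N a with P w, (w.map T).prod) * (∑ w ∈ words N b with Q w, (w.map T).prod) =
      ∑ w ∈ words N (a + b) with P (w.take a) ∧ Q (w.drop a), (w.map T).prod := by
  rw [Finset.sum_mul_sum, ← Finset.sum_product']
  refine Finset.sum_nbij' (fun p => p.1 ++ p.2) (fun w => (w.take a, w.drop a)) ?_ ?_ ?_ ?_ ?_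
  · rintro ⟨u, v⟩ h
    simp only [Finset.mem_product, Finset.mem_filter, mem_words] at h ⊢
    obtain ⟨⟨⟨rfl, hu⟩, hP⟩, ⟨rfl, hv⟩, hQ⟩ := h
    refine ⟨⟨by simp, ?_⟩, by simpa using ⟨hP, hQ⟩⟩
    intro i hi
    rcases List.mem_append.1 hi with h | h
    exacts [hu i h, hv i h]
  · intro w h
    simp only [Finset.mem_product, Finset.mem_filter, mem_words] at h ⊢
    obtain ⟨⟨h1, h2⟩, h3, h4⟩ := h
    exact ⟨⟨⟨by simp [h1], fun i hi => h2 i (List.mem_of_mem_take hi)⟩, h3⟩,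
      ⟨by simp [h1], fun i hi => h2 i (List.mem_of_mem_drop hi)⟩, h4⟩
  · rintro ⟨u, v⟩ h
    simp only [Finset.mem_product, Finset.mem_filter, mem_words] at h
    obtain ⟨⟨⟨rfl, hu⟩, hP⟩, ⟨rfl, hv⟩, hQ⟩ := h
    simp
  · intro w _
    simp
  · rintro ⟨u, v⟩ _
    simp

lemma descentSum_mul (T : ℕ+ → A) (N a b : ℕ+) (γ : List ℕ+) :
    descentSum T N a ∅ * descentSum T N (size (b :: γ)) (partialSums (b :: γ)) =
      descentSum T N (size (a :: b :: γ)) (partialSums (a :: b :: γ)) +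
      descentSum T N (size ((a + b) :: γ)) (partialSums ((a + b) :: γ)) := by
  classical
  have hs : size ((a + b) :: γ) = a + size (b :: γ) := by simp [add_assoc]
  rw [size_cons a, hs]
  unfold descentSum
  rw [sum_words_mul_sum_words T N a _ (fun w => wordDes w = ∅)
    (fun w => wordDes w = partialSums (b :: γ)), ← Finset.sum_union]
  · refine Finset.sum_congr ?_ fun _ _ => rfl
    ext w
    simp only [Finset.mem_union, Finset.mem_filter, ← and_or_left]
    refine and_congr_right fun hw => ?_
    have h := (mem_words.1 hw).1
    rw [wordDes_append_iff (a := a) (by simp [h]), List.take_append_drop]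
  · rw [Finset.disjoint_filter]
    intro w _ h1 h2
    have h3 : (a : ℕ) ∈ partialSums (a :: b :: γ) := mem_partialSums_cons_cons.2 (Or.inl rfl)
    rw [← h1, h2, mem_partialSums_add_cons] at h3
    obtain ⟨y, hy, h⟩ := h3
    have := pos_of_mem_partialSums hy
    omega

variable [Algebra ℚ A]

/-- The algebra homomorphism from `NSym` sending `h_a` to the sum of all strictly decreasing words
of length `a` in `T_1, …, T_N`. -/
noncomputable def wordHom (T : ℕ+ → A) (N : ℕ+) : NSym →ₐ[ℚ] A :=
  FreeAlgebra.lift ℚ fun a : ℕ+ => descentSum T N a ∅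

/-- The ribbons and the word sums `descentSum` satisfy the same product rule, so `r_β` is sent to the
sum of the words with descent composition `β`. -/
lemma wordHom_ribbon (T : ℕ+ → A) (N : ℕ+) (β : List ℕ+) :
    wordHom T N (ribbon β) = descentSum T N (size β) (partialSums β) := by
  induction hn : β.length generalizing β with
  | zero =>
    rw [List.length_eq_zero_iff] at hn
    subst hn
    have h : wordDes [] = partialSums [] := by ext; simp [wordDes, partialSums]
    rw [ribbon_nil, map_one, descentSum]
    simp [words, Finset.filter_singleton, h]
  | succ n ih =>
    match β, hn with
    | [a], _ => rw [ribbon_singleton, partialSums_singleton, size_singleton, wordHom,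
        FreeAlgebra.lift_ι_apply]
    | a :: b :: γ, hn =>
      have h := congrArg (wordHom T N) (ι_mul_ribbon a b γ)
      rw [map_mul, map_add, ih (b :: γ) (by simpa using hn), ih ((a + b) :: γ) (by simpa using hn),
        wordHom, FreeAlgebra.lift_ι_apply, descentSum_mul] at h
      exact (add_right_cancel h).symm

end Representation

/-! ### The span of the ribbons of a given size -/

/-- The span of the ribbons `r_β` with `|β| = n`, i.e. the homogeneous component of degree `n`. -/
noncomputable def ribbonSpan (n : ℕ) : Submodule ℚ NSym :=
  Submodule.span ℚ (ribbon '' {β | size β = n})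

lemma ι_mul_mem_ribbonSpan (a : ℕ+) {n : ℕ} {x : NSym} (hx : x ∈ ribbonSpan n) :
    FreeAlgebra.ι ℚ a * x ∈ ribbonSpan (a + n) := by
  induction hx using Submodule.span_induction with
  | mem x h =>
    obtain ⟨β, rfl, rfl⟩ := h
    cases β with
    | nil =>
      rw [ribbon_nil, mul_one, ← ribbon_singleton]
      exact Submodule.subset_span ⟨[a], by simp, rfl⟩
    | cons b γ =>
      rw [ι_mul_ribbon]
      exact add_mem (Submodule.subset_span ⟨_, by simp, rfl⟩)
        (Submodule.subset_span ⟨_, by simp [add_assoc], rfl⟩)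
  | zero => rw [mul_zero]; exact zero_mem _
  | add x y _ _ hx hy => rw [mul_add]; exact add_mem hx hy
  | smul c x _ hx => rw [mul_smul_comm]; exact Submodule.smul_mem _ _ hx

lemma ribbon_mul_mem_ribbonSpan (β : List ℕ+) {n : ℕ} {x : NSym} (hx : x ∈ ribbonSpan n) :
    ribbon β * x ∈ ribbonSpan (size β + n) := by
  induction hm : β.length generalizing β with
  | zero =>
    rw [List.length_eq_zero_iff] at hm
    subst hm
    rwa [ribbon_nil, one_mul, size_nil, zero_add]
  | succ m ih =>
    match β, hm with
    | [a], _ => rw [ribbon_singleton, size_singleton]; exact ι_mul_mem_ribbonSpan a hx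
    | a :: b :: γ, hm =>
      rw [eq_sub_of_add_eq (ι_mul_ribbon a b γ).symm, sub_mul, mul_assoc]
      have h1 := ι_mul_mem_ribbonSpan a (ih (b :: γ) (by simpa using hm))
      have h2 := ih ((a + b) :: γ) (by simpa using hm)
      simp only [size_cons, PNat.add_coe, add_assoc] at h1 h2 ⊢
      exact sub_mem h1 h2

lemma ncSchur_mem_ribbonSpan (α : List ℕ+) : ncSchur α ∈ ribbonSpan (size α) :=
  Submodule.sum_mem _ fun β _ => Submodule.smul_mem _ _ (Submodule.subset_span ⟨β.1, β.2, rfl⟩)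

/-! ### Tableaux as chains of box additions -/

lemma mem_diagram_cons_zero {a : ℕ+} {γ : List ℕ+} {j : ℕ} :
    (0, j) ∈ diagram (a :: γ) ↔ j < a := by
  simp [mem_diagram]

lemma mem_diagram_cons_succ {a : ℕ+} {γ : List ℕ+} {i j : ℕ} :
    (i + 1, j) ∈ diagram (a :: γ) ↔ (i, j) ∈ diagram γ := by
  simp [mem_diagram]

lemma mem_diagram_length {p s : List ℕ+} {a : ℕ+} {j : ℕ} :
    (p.length, j) ∈ diagram (p ++ a :: s) ↔ j < a := by
  simp [mem_diagram]

/-- Lengthening one row by one box. -/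
lemma mem_diagram_extend {p s : List ℕ+} {a : ℕ+} {i j : ℕ} :
    (i, j) ∈ diagram (p ++ (a + 1) :: s) ↔
      (i = p.length ∧ j = a) ∨ (i, j) ∈ diagram (p ++ a :: s) := by
  induction p generalizing i with
  | nil =>
    cases i with
    | zero =>
      simp only [List.nil_append, mem_diagram_cons_zero, PNat.add_coe, PNat.one_coe,
        List.length_nil, true_and]
      omega
    | succ i => simp [mem_diagram_cons_succ]
  | cons b p ih =>
    cases i with
    | zero => simp [mem_diagram_cons_zero]
    | succ i => simp [mem_diagram_cons_succ, ih]

lemma IsSSRCT.pos_iff {γ : List ℕ+} {τ : ℕ → ℕ → ℕ} (h : IsSSRCT γ τ) {i j : ℕ} :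
    0 < τ i j ↔ (i, j) ∈ diagram γ := by
  constructor
  · intro h1
    by_contra h2
    exact h1.ne' (h.zeros i j h2)
  · exact h.pos i j

/-- Increases the entries of a filling by `1` and puts a row consisting of one box with entry `1` on
top. -/
def addTop (τ : ℕ → ℕ → ℕ) : ℕ → ℕ → ℕ
  | 0, j => if j = 0 then 1 else 0
  | i + 1, j => if τ i j = 0 then 0 else τ i j + 1

/-- Increases the entries of a filling by `1` and adds a box with entry `1` in row `r` and
column `c`. -/
def addAt (r c : ℕ) (τ : ℕ → ℕ → ℕ) (i j : ℕ) : ℕ :=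
  if i = r ∧ j = c then 1 else if τ i j = 0 then 0 else τ i j + 1

lemma addTop_succ_of_mem {γ : List ℕ+} {τ : ℕ → ℕ → ℕ} (h : IsSSRCT γ τ) {i j : ℕ}
    (hij : (i, j) ∈ diagram γ) : addTop τ (i + 1) j = τ i j + 1 := by
  rw [addTop, if_neg (h.pos i j hij).ne']

lemma addAt_self (r c : ℕ) (τ : ℕ → ℕ → ℕ) : addAt r c τ r c = 1 := by simp [addAt]

lemma addAt_of_mem {p s : List ℕ+} {a : ℕ+} {τ : ℕ → ℕ → ℕ} (h : IsSSRCT (p ++ a :: s) τ)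
    {i j : ℕ} (hij : (i, j) ∈ diagram (p ++ a :: s)) :
    addAt p.length a τ i j = τ i j + 1 := by
  rw [addAt, if_neg, if_neg (h.pos i j hij).ne']
  rintro ⟨rfl, rfl⟩
  simp [mem_diagram_length] at hij

lemma IsSRCT.le_size {γ : List ℕ+} {τ : ℕ → ℕ → ℕ} (h : IsSRCT γ τ) {i j : ℕ}
    (hij : (i, j) ∈ diagram γ) : τ i j ≤ size γ := (h.standard.mapsTo hij).2

/-- The entries of an SRCT strictly decrease along rows. -/
lemma IsSRCT.row_strict {γ : List ℕ+} {τ : ℕ → ℕ → ℕ} (h : IsSRCT γ τ) {i j j' : ℕ} (hj : j < j')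
    (hij : (i, j') ∈ diagram γ) : τ i j' < τ i j := by
  refine lt_of_le_of_ne (h.row_weak i j j' hj hij) fun e => ?_
  have := (h.inj hij (diagram_left hij hj.le) e).2
  omega

lemma isSRCT_addTop {γ : List ℕ+} {τ : ℕ → ℕ → ℕ} (h : IsSRCT γ τ) :
    IsSRCT (1 :: γ) (addTop τ) where
  zeros i j hij := by
    cases i with
    | zero =>
      rw [mem_diagram_cons_zero, PNat.one_coe] at hij
      rw [addTop, if_neg (by omega)]
    | succ i =>
      rw [mem_diagram_cons_succ] at hij
      rw [addTop, if_pos (h.zeros i j hij)]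
  pos i j hij := by
    cases i with
    | zero =>
      rw [mem_diagram_cons_zero, PNat.one_coe] at hij
      rw [addTop, if_pos (by omega)]
      exact one_pos
    | succ i =>
      rw [mem_diagram_cons_succ] at hij
      rw [addTop_succ_of_mem h.toIsSSRCT hij]
      omega
  row_weak i j j' hj hij := by
    cases i with
    | zero =>
      rw [mem_diagram_cons_zero, PNat.one_coe] at hij
      omega
    | succ i =>
      rw [mem_diagram_cons_succ] at hij
      rw [addTop_succ_of_mem h.toIsSSRCT hij,
        addTop_succ_of_mem h.toIsSSRCT (diagram_left hij hj.le)]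
      have := h.row_weak i j j' hj hij
      omega
  col_strict i i' hi hij := by
    obtain ⟨i', rfl⟩ := Nat.exists_eq_succ_of_ne_zero (show i' ≠ 0 by omega)
    rw [Nat.succ_eq_add_one, mem_diagram_cons_succ] at hij
    rw [Nat.succ_eq_add_one, addTop_succ_of_mem h.toIsSSRCT hij]
    have h1 := h.pos _ _ hij
    cases i with
    | zero => simp [addTop]; omega
    | succ i =>
      rw [addTop_succ_of_mem h.toIsSSRCT ⟨by have := hij.1; dsimp at this ⊢; omega, PNat.pos _⟩]
      have := h.col_strict i i' (by omega) hij
      omega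
  triple i j k hij h1 h2 hle := by
    obtain ⟨j, rfl⟩ := Nat.exists_eq_succ_of_ne_zero (show j ≠ 0 by omega)
    rw [Nat.succ_eq_add_one] at *
    rw [mem_diagram_cons_succ] at h2
    rw [addTop_succ_of_mem h.toIsSSRCT h2] at hle ⊢
    have h3 := h.pos _ _ h2
    cases i with
    | zero =>
      rw [mem_diagram_cons_zero, PNat.one_coe] at h1
      rw [addTop, if_pos (by omega)] at hle
      omega
    | succ i =>
      rw [mem_diagram_cons_succ] at h1
      rw [addTop_succ_of_mem h.toIsSSRCT h1] at hle
      obtain ⟨h4, h5⟩ := h.triple i j k (by omega) h1 h2 (by omega)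
      rw [mem_diagram_cons_succ, addTop_succ_of_mem h.toIsSSRCT h4]
      exact ⟨h4, by omega⟩
  standard := by
    have hsz : size (1 :: γ) = size γ + 1 := by rw [size_cons, PNat.one_coe, add_comm]
    rw [hsz]
    refine ⟨?_, ?_, ?_⟩
    · rintro ⟨i, j⟩ hij
      cases i with
      | zero =>
        rw [mem_diagram_cons_zero, PNat.one_coe] at hij
        simp [addTop, show j = 0 by omega]
      | succ i =>
        rw [mem_diagram_cons_succ] at hij
        have := h.le_size hij
        dsimp only
        rw [addTop_succ_of_mem h.toIsSSRCT hij]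
        exact ⟨by omega, by omega⟩
    · rintro ⟨i, j⟩ hij ⟨i', j'⟩ hij' e
      dsimp only at e
      cases i with
      | zero =>
        rw [mem_diagram_cons_zero, PNat.one_coe] at hij
        cases i' with
        | zero =>
          rw [mem_diagram_cons_zero, PNat.one_coe] at hij'
          rw [show j = j' by omega]
        | succ i' =>
          rw [mem_diagram_cons_succ] at hij'
          have := h.pos _ _ hij'
          rw [addTop_succ_of_mem h.toIsSSRCT hij', addTop, if_pos (by omega)] at e
          omega
      | succ i =>
        rw [mem_diagram_cons_succ] at hij
        have := h.pos _ _ hij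
        rw [addTop_succ_of_mem h.toIsSSRCT hij] at e
        cases i' with
        | zero =>
          rw [mem_diagram_cons_zero, PNat.one_coe] at hij'
          rw [addTop, if_pos (by omega)] at e
          omega
        | succ i' =>
          rw [mem_diagram_cons_succ] at hij'
          rw [addTop_succ_of_mem h.toIsSSRCT hij'] at e
          obtain ⟨rfl, rfl⟩ := h.inj hij hij' (by omega)
          rfl
    · rintro v ⟨hv1, hv2⟩
      rcases Nat.eq_or_lt_of_le hv1 with rfl | hv
      · exact ⟨(0, 0), by simp [mem_diagram_cons_zero], by simp [addTop]⟩
      · obtain ⟨i, j, hij, e⟩ := h.surj (v := v - 1) (by omega) (by omega)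
        refine ⟨(i + 1, j), mem_diagram_cons_succ.2 hij, ?_⟩
        dsimp only
        rw [addTop_succ_of_mem h.toIsSSRCT hij]
        omega

lemma isSRCT_addAt {p s : List ℕ+} {a : ℕ+} (ha : a ∉ p) {τ : ℕ → ℕ → ℕ}
    (h : IsSRCT (p ++ a :: s) τ) : IsSRCT (p ++ (a + 1) :: s) (addAt p.length a τ) where
  zeros i j hij := by
    rw [mem_diagram_extend, not_or] at hij
    rw [addAt, if_neg hij.1, if_pos (h.zeros i j hij.2)]
  pos i j hij := by
    rcases mem_diagram_extend.1 hij with ⟨rfl, rfl⟩ | hij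
    · rw [addAt_self]; exact one_pos
    · rw [addAt_of_mem h.toIsSSRCT hij]; omega
  row_weak i j j' hj hij := by
    have hleft : (i, j) ∈ diagram (p ++ a :: s) := by
      rcases mem_diagram_extend.1 hij with ⟨rfl, rfl⟩ | hij
      · exact mem_diagram_length.2 hj
      · exact diagram_left hij hj.le
    rw [addAt_of_mem h.toIsSSRCT hleft]
    rcases mem_diagram_extend.1 hij with ⟨rfl, rfl⟩ | hij
    · rw [addAt_self]; omega
    · rw [addAt_of_mem h.toIsSSRCT hij]
      have := h.row_weak i j j' hj hij
      omega
  col_strict i i' hi hij := by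
    have ha := a.pos
    have h1 : (i', 0) ∈ diagram (p ++ a :: s) := by
      rcases mem_diagram_extend.1 hij with ⟨-, h⟩ | h
      · omega
      · exact h
    rw [addAt_of_mem h.toIsSSRCT h1,
      addAt_of_mem h.toIsSSRCT ⟨by have := h1.1; dsimp at this ⊢; omega, PNat.pos _⟩]
    have := h.col_strict i i' hi h1
    omega
  triple i j k hij h1 h2 hle := by
    rcases mem_diagram_extend.1 h2 with ⟨rfl, hk⟩ | h2
    · -- the new box ends the lower row; the upper row does not end in the column before it
      have h3 : (i, k + 1) ∈ diagram (p ++ a :: s) := by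
        have hi : i < (p ++ a :: s).length := by simp; omega
        have h4 : (i, k) ∈ diagram (p ++ a :: s) := by
          rcases mem_diagram_extend.1 h1 with ⟨rfl, -⟩ | h
          · omega
          · exact h
        obtain ⟨h5, h6⟩ := h4
        refine ⟨h5, lt_of_le_of_ne h6 fun e => ha ?_⟩
        dsimp only at e
        rw [hk, PNat.coe_inj, List.getElem_append_left hij] at e
        rw [e]
        exact List.getElem_mem _
      refine ⟨mem_diagram_extend.2 (Or.inr h3), ?_⟩
      rw [addAt_of_mem h.toIsSSRCT h3, hk, addAt_self]
      have := h.pos _ _ h3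
      rw [hk] at this
      omega
    · rw [addAt_of_mem h.toIsSSRCT h2] at hle ⊢
      have h3 := h.pos _ _ h2
      rcases mem_diagram_extend.1 h1 with ⟨rfl, rfl⟩ | h1
      · rw [addAt_self] at hle
        omega
      · rw [addAt_of_mem h.toIsSSRCT h1] at hle
        obtain ⟨h4, h5⟩ := h.triple i j k hij h1 h2 (by omega)
        refine ⟨mem_diagram_extend.2 (Or.inr h4), ?_⟩
        rw [addAt_of_mem h.toIsSSRCT h4]
        omega
  standard := by
    have hsz : size (p ++ (a + 1) :: s) = size (p ++ a :: s) + 1 := by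
      simp only [size_append, size_cons, PNat.add_coe, PNat.one_coe]
      omega
    rw [hsz]
    refine ⟨?_, ?_, ?_⟩
    · rintro ⟨i, j⟩ hij
      rcases mem_diagram_extend.1 hij with ⟨rfl, rfl⟩ | hij
      · simp [addAt_self]
      · have := h.le_size hij
        dsimp only
        rw [addAt_of_mem h.toIsSSRCT hij]
        exact ⟨by omega, by omega⟩
    · rintro ⟨i, j⟩ hij ⟨i', j'⟩ hij' e
      dsimp only at e
      rcases mem_diagram_extend.1 hij with ⟨rfl, rfl⟩ | hij
      · rcases mem_diagram_extend.1 hij' with ⟨rfl, rfl⟩ | hij'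
        · rfl
        · have := h.pos _ _ hij'
          rw [addAt_self, addAt_of_mem h.toIsSSRCT hij'] at e
          omega
      · have := h.pos _ _ hij
        rw [addAt_of_mem h.toIsSSRCT hij] at e
        rcases mem_diagram_extend.1 hij' with ⟨rfl, rfl⟩ | hij'
        · rw [addAt_self] at e
          omega
        · rw [addAt_of_mem h.toIsSSRCT hij'] at e
          obtain ⟨rfl, rfl⟩ := h.inj hij hij' (by omega)
          rfl
    · rintro v ⟨hv1, hv2⟩
      rcases Nat.eq_or_lt_of_le hv1 with rfl | hv
      · exact ⟨(p.length, a), mem_diagram_extend.2 (Or.inl ⟨rfl, rfl⟩), addAt_self _ _ _⟩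
      · obtain ⟨i, j, hij, e⟩ := h.surj (v := v - 1) (by omega) (by omega)
        refine ⟨(i, j), mem_diagram_extend.2 (Or.inr hij), ?_⟩
        dsimp only
        rw [addAt_of_mem h.toIsSSRCT hij]
        omega

/-- Removing the box with entry `1` when it forms the top row. -/
lemma IsSRCT.exists_eq_addTop {γ : List ℕ+} {τ : ℕ → ℕ → ℕ} (h : IsSRCT (1 :: γ) τ)
    (h1 : τ 0 0 = 1) : ∃ τ', IsSRCT γ τ' ∧ τ = addTop τ' := by
  have hmem : (0, 0) ∈ diagram (1 :: γ) := by simp [mem_diagram_cons_zero]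
  have key : ∀ i j, (i, j) ∈ diagram γ → 2 ≤ τ (i + 1) j := by
    intro i j hij
    have h2 := mem_diagram_cons_succ (a := 1).2 hij
    have h3 := h.pos _ _ h2
    have h4 : τ (i + 1) j ≠ 1 := fun e => by
      have := (h.inj h2 hmem (by omega)).1
      omega
    omega
  have hsz : size (1 :: γ) = size γ + 1 := by rw [size_cons, PNat.one_coe, add_comm]
  have hz : ∀ i j, (i, j) ∉ diagram γ → τ (i + 1) j = 0 := fun i j hij =>
    h.zeros _ _ (fun h' => hij (mem_diagram_cons_succ.1 h'))
  refine ⟨fun i j => τ (i + 1) j - 1, ⟨⟨?_, ?_, ?_, ?_, ?_⟩, ?_, ?_, ?_⟩, ?_⟩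
  · intro i j hij
    simp [hz i j hij]
  · intro i j hij
    have := key i j hij
    omega
  · intro i j j' hj hij
    have := h.row_weak (i + 1) j j' hj (mem_diagram_cons_succ.2 hij)
    omega
  · intro i i' hi hij
    have h2 := h.col_strict (i + 1) (i' + 1) (by omega) (mem_diagram_cons_succ.2 hij)
    have h3 := key i 0 ⟨by have := hij.1; dsimp at this ⊢; omega, PNat.pos _⟩
    omega
  · intro i j k hij h2 h3 hle
    have h4 := key _ _ h2
    have h5 := key _ _ h3
    obtain ⟨h6, h7⟩ := h.triple (i + 1) (j + 1) k (by omega) (mem_diagram_cons_succ.2 h2)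
      (mem_diagram_cons_succ.2 h3) (by omega)
    exact ⟨mem_diagram_cons_succ.1 h6, by omega⟩
  · rintro ⟨i, j⟩ hij
    have h2 := key _ _ hij
    have h3 := h.le_size (mem_diagram_cons_succ (a := 1).2 hij)
    exact ⟨by dsimp only; omega, by dsimp only; omega⟩
  · rintro ⟨i, j⟩ hij ⟨i', j'⟩ hij' e
    have h2 := key _ _ hij
    have h3 := key _ _ hij'
    dsimp only at e
    obtain ⟨h4, rfl⟩ := h.inj (mem_diagram_cons_succ (a := 1).2 hij)
      (mem_diagram_cons_succ (a := 1).2 hij') (by omega)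
    rw [add_right_cancel h4]
  · rintro v ⟨hv1, hv2⟩
    obtain ⟨i, j, hij, e⟩ := h.surj (v := v + 1) (by omega) (by omega)
    cases i with
    | zero =>
      rw [mem_diagram_cons_zero, PNat.one_coe] at hij
      obtain rfl : j = 0 := by omega
      omega
    | succ i => exact ⟨(i, j), mem_diagram_cons_succ.1 hij, by dsimp only; omega⟩
  · funext i j
    cases i with
    | zero =>
      rw [addTop]
      split_ifs with hj
      · rw [hj, h1]
      · exact h.zeros _ _ (by rw [mem_diagram_cons_zero, PNat.one_coe]; omega)
    | succ i =>
      rw [addTop]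
      by_cases hij : (i, j) ∈ diagram γ
      · have := key _ _ hij
        rw [if_neg (by omega)]
        omega
      · simp [hz i j hij]

/-- Removing the box with entry `1` when it is not in the first column. -/
lemma IsSRCT.exists_eq_addAt {p s : List ℕ+} {a : ℕ+} {τ : ℕ → ℕ → ℕ}
    (h : IsSRCT (p ++ (a + 1) :: s) τ) (h1 : τ p.length a = 1) :
    a ∉ p ∧ ∃ τ', IsSRCT (p ++ a :: s) τ' ∧ τ = addAt p.length a τ' := by
  have hapos := a.pos
  have hmem : (p.length, (a : ℕ)) ∈ diagram (p ++ (a + 1) :: s) :=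
    mem_diagram_extend.2 (Or.inl ⟨rfl, rfl⟩)
  have hsub : ∀ {i j}, (i, j) ∈ diagram (p ++ a :: s) → (i, j) ∈ diagram (p ++ (a + 1) :: s) :=
    fun h => mem_diagram_extend.2 (Or.inr h)
  have key : ∀ i j, (i, j) ∈ diagram (p ++ a :: s) → 2 ≤ τ i j := by
    intro i j hij
    have h3 := h.pos _ _ (hsub hij)
    have h4 : τ i j ≠ 1 := fun e => by
      obtain ⟨rfl, rfl⟩ := h.inj (hsub hij) hmem (by omega)
      simp [mem_diagram_length] at hij
    omega
  have hsz : size (p ++ (a + 1) :: s) = size (p ++ a :: s) + 1 := by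
    simp only [size_append, size_cons, PNat.add_coe, PNat.one_coe]
    omega
  refine ⟨?_, fun i j => τ i j - 1, ⟨⟨?_, ?_, ?_, ?_, ?_⟩, ?_, ?_, ?_⟩, ?_⟩
  · -- a row of length `a` above the box with entry `1` would violate the triple condition
    intro hap
    obtain ⟨i, hi, e⟩ := List.getElem_of_mem hap
    have h2 : (i, (a : ℕ) - 1) ∈ diagram (p ++ (a + 1) :: s) :=
      ⟨by simp; omega, by dsimp only; rw [List.getElem_append_left hi, e]; omega⟩
    have h3 := h.pos _ _ h2
    have ha1 : (a : ℕ) - 1 + 1 = a := by omega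
    obtain ⟨⟨h4, h5⟩, -⟩ := h.triple i p.length ((a : ℕ) - 1) hi h2 (by rwa [ha1])
      (by rw [ha1]; omega)
    dsimp only at h5
    rw [List.getElem_append_left hi, e] at h5
    omega
  · intro i j hij
    by_cases h' : (i, j) ∈ diagram (p ++ (a + 1) :: s)
    · rcases mem_diagram_extend.1 h' with ⟨rfl, rfl⟩ | h'
      · rw [h1]
      · exact absurd h' hij
    · rw [h.zeros _ _ h']
  · intro i j hij
    have := key i j hij
    omega
  · intro i j j' hj hij
    have := h.row_weak i j j' hj (hsub hij)
    omega
  · intro i i' hi hij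
    have h2 := h.col_strict i i' hi (hsub hij)
    have h3 := key i 0 ⟨by have := hij.1; dsimp at this ⊢; omega, PNat.pos _⟩
    omega
  · intro i j k hij h2 h3 hle
    have h4 := key _ _ h2
    have h5 := key _ _ h3
    obtain ⟨h6, h7⟩ := h.triple i j k hij (hsub h2) (hsub h3) (by omega)
    rcases mem_diagram_extend.1 h6 with ⟨rfl, hk⟩ | h6
    · rw [hk] at h5 h7
      omega
    · exact ⟨h6, by omega⟩
  · rintro ⟨i, j⟩ hij
    have h2 := key _ _ hij
    have h3 := h.le_size (hsub hij)
    exact ⟨by dsimp only; omega, by dsimp only; omega⟩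
  · rintro ⟨i, j⟩ hij ⟨i', j'⟩ hij' e
    have h2 := key _ _ hij
    have h3 := key _ _ hij'
    dsimp only at e
    obtain ⟨rfl, rfl⟩ := h.inj (hsub hij) (hsub hij') (by omega)
    rfl
  · rintro v ⟨hv1, hv2⟩
    obtain ⟨i, j, hij, e⟩ := h.surj (v := v + 1) (by omega) (by omega)
    rcases mem_diagram_extend.1 hij with ⟨rfl, rfl⟩ | hij
    · omega
    · exact ⟨(i, j), hij, by dsimp only; omega⟩
  · funext i j
    rw [addAt]
    split_ifs with h2 h3
    · rw [h2.1, h2.2, h1]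
    · by_contra h4
      rcases mem_diagram_extend.1 (h.pos_iff.1 (Nat.pos_of_ne_zero h4)) with h5 | h5
      · exact h2 h5
      · have := key _ _ h5
        omega
    · omega

/-- The box with entry `1` can be removed from an SRCT: it is the top row, or the last box of the
first row of its length. -/
lemma IsSRCT.exists_removal {γ : List ℕ+} {τ : ℕ → ℕ → ℕ} (h : IsSRCT γ τ) (hγ : γ ≠ []) :
    (∃ γ' τ', γ = 1 :: γ' ∧ IsSRCT γ' τ' ∧ τ = addTop τ') ∨
    ∃ (p s : List ℕ+) (a : ℕ+) (τ' : ℕ → ℕ → ℕ), γ = p ++ (a + 1) :: s ∧ a ∉ p ∧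
      IsSRCT (p ++ a :: s) τ' ∧ τ = addAt p.length a τ' := by
  have hsz : 1 ≤ size γ := (List.length_pos_iff.2 hγ).trans_le (length_le_size γ)
  obtain ⟨r, c, hrc, h1⟩ := h.surj one_pos hsz
  have hend : (r, c + 1) ∉ diagram γ := fun h2 => by
    have h3 := h.row_strict (Nat.lt_add_one c) h2
    have h4 := h.pos _ _ h2
    omega
  obtain ⟨hr, hc⟩ := id hrc
  dsimp only at hr hc
  have hlen : (γ[r] : ℕ) = c + 1 := by
    by_contra hne
    exact hend ⟨hr, by dsimp only; omega⟩
  obtain ⟨p, x, s, rfl, rfl, hx⟩ : ∃ (p : List ℕ+) (x : ℕ+) (s : List ℕ+),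
      γ = p ++ x :: s ∧ r = p.length ∧ (x : ℕ) = c + 1 :=
    ⟨γ.take r, γ[r], γ.drop (r + 1), by simp, by simp; omega, hlen⟩
  rcases Nat.eq_zero_or_pos c with rfl | hc
  · left
    have hp : p = [] := by
      by_contra hp
      have h2 := h.col_strict 0 p.length (List.length_pos_iff.2 hp) hrc
      have h3 := h.pos 0 0 ⟨by simp, PNat.pos _⟩
      omega
    subst hp
    obtain rfl : x = 1 := PNat.coe_inj.1 hx
    obtain ⟨τ', h2, h3⟩ := h.exists_eq_addTop h1
    exact ⟨s, τ', rfl, h2, h3⟩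
  · right
    obtain ⟨a, rfl⟩ : ∃ a : ℕ+, c = a := ⟨⟨c, hc⟩, rfl⟩
    obtain rfl : x = a + 1 := PNat.coe_inj.1 hx
    obtain ⟨h2, τ', h3, h4⟩ := h.exists_eq_addAt h1
    exact ⟨p, s, a, τ', rfl, h2, h3, h4⟩

/-- `Chain w γ τ`: the boxes of the tableau `τ` of shape `γ` are added to the empty diagram in the
order of decreasing entries, in the columns given by the letters of `w` read from right to left. -/
inductive Chain : List ℕ+ → List ℕ+ → (ℕ → ℕ → ℕ) → Prop
  | nil : Chain [] [] (fun _ _ => 0)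
  | new {w γ τ} (h : Chain w γ τ) : Chain (1 :: w) (1 :: γ) (addTop τ)
  | extend {w τ} (p s : List ℕ+) (a : ℕ+) (ha : a ∉ p) (h : Chain w (p ++ a :: s) τ) :
      Chain ((a + 1) :: w) (p ++ (a + 1) :: s) (addAt p.length a τ)

lemma isSRCT_nil : IsSRCT [] (fun _ _ => 0) where
  zeros _ _ _ := rfl
  pos i j h := by simp [mem_diagram] at h
  row_weak i j j' _ h := by simp [mem_diagram] at h
  col_strict i i' _ h := by simp [mem_diagram] at h
  triple i j k _ h := by simp [mem_diagram] at h
  standard := by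
    have : diagram [] = ∅ := Set.eq_empty_of_forall_notMem fun x h => by simp [diagram] at h
    rw [this, size_nil, Set.Icc_eq_empty (by omega)]
    exact Set.bijOn_empty _

lemma IsSRCT.eq_zero {τ : ℕ → ℕ → ℕ} (h : IsSRCT [] τ) : τ = fun _ _ => 0 := by
  funext i j
  exact h.zeros i j (by simp [mem_diagram])

lemma wordAct_cons (i : ℕ+) (w α : List ℕ+) :
    wordAct (i :: w) α = (wordAct w α).bind (boxAdd i) := rfl

lemma wordAct_cons_eq_some_iff {i : ℕ+} {w α γ : List ℕ+} :
    wordAct (i :: w) α = some γ ↔ ∃ γ', wordAct w α = some γ' ∧ CoverInColumn i γ' γ := by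
  simp only [wordAct_cons, Option.bind_eq_some_iff, boxAdd_eq_some_iff]

namespace Chain

variable {w γ : List ℕ+} {τ : ℕ → ℕ → ℕ}

lemma isSRCT (h : Chain w γ τ) : IsSRCT γ τ := by
  induction h with
  | nil => exact isSRCT_nil
  | new _ ih => exact isSRCT_addTop ih
  | extend p s a ha _ ih => exact isSRCT_addAt ha ih

lemma wordAct_eq (h : Chain w γ τ) : wordAct w [] = some γ := by
  induction h with
  | nil => rfl
  | new _ ih => exact wordAct_cons_eq_some_iff.2 ⟨_, ih, .new _⟩
  | extend p s a ha _ ih => exact wordAct_cons_eq_some_iff.2 ⟨_, ih, .extend p s a ha⟩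

/-- The letter of `w` at position `v` is the column of the box with entry `v`. -/
lemma getElem?_eq (h : Chain w γ τ) {i j : ℕ} (hij : (i, j) ∈ diagram γ) :
    w[τ i j - 1]? = some j.succPNat := by
  induction h generalizing i j with
  | nil => simp [mem_diagram] at hij
  | new h ih =>
    cases i with
    | zero =>
      rw [mem_diagram_cons_zero, PNat.one_coe] at hij
      obtain rfl : j = 0 := by omega
      simp [addTop]
      rfl
    | succ i =>
      rw [mem_diagram_cons_succ] at hij
      have h1 := h.isSRCT.pos _ _ hij
      rw [addTop_succ_of_mem h.isSRCT.toIsSSRCT hij, ← ih hij]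
      obtain ⟨v, hv⟩ := Nat.exists_eq_succ_of_ne_zero h1.ne'
      simp [hv]
  | extend p s a ha h ih =>
    rcases mem_diagram_extend.1 hij with ⟨rfl, rfl⟩ | hij
    · simp [addAt_self]
      rfl
    · have h1 := h.isSRCT.pos _ _ hij
      rw [addAt_of_mem h.isSRCT.toIsSSRCT hij, ← ih hij]
      obtain ⟨v, hv⟩ := Nat.exists_eq_succ_of_ne_zero h1.ne'
      simp [hv]

lemma length_eq (h : Chain w γ τ) : w.length = size γ := by
  induction h with
  | nil => rfl
  | new _ ih => simp [ih, add_comm]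
  | extend p s a ha _ ih => simp [ih]; omega

/-- A word is determined by its tableau. -/
lemma word_unique {w' : List ℕ+} (h : Chain w γ τ) (h' : Chain w' γ τ) : w = w' := by
  refine List.ext_getElem? fun v => ?_
  rcases lt_or_ge v (size γ) with hv | hv
  · obtain ⟨i, j, hij, e⟩ := h.isSRCT.surj (v := v + 1) (by omega) (by omega)
    obtain rfl : v = τ i j - 1 := by omega
    rw [h.getElem?_eq hij, h'.getElem?_eq hij]
  · rw [List.getElem?_eq_none (by rw [h.length_eq]; exact hv),
      List.getElem?_eq_none (by rw [h'.length_eq]; exact hv)]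

/-- A tableau is determined by its word. -/
lemma tableau_unique {γ' : List ℕ+} {τ' : ℕ → ℕ → ℕ} (h : Chain w γ τ) (h' : Chain w γ' τ') :
    τ = τ' := by
  induction h generalizing γ' τ' with
  | nil =>
    cases h'
    rfl
  | new h ih =>
    generalize hw : (1 : ℕ+) :: _ = w' at h'
    cases h' with
    | nil => simp at hw
    | new h' =>
      obtain rfl := List.tail_eq_of_cons_eq hw
      rw [ih h']
    | extend p s a ha h' => exact absurd (List.head_eq_of_cons_eq hw) (PNat.lt_add_left 1 a).ne
  | extend p s a ha h ih =>
    generalize hw : (a + 1 : ℕ+) :: _ = w' at h'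
    cases h' with
    | nil => simp at hw
    | new h' => exact absurd (List.head_eq_of_cons_eq hw).symm (PNat.lt_add_left 1 a).ne
    | extend p' s' a' ha' h' =>
      obtain rfl := List.tail_eq_of_cons_eq hw
      obtain rfl := add_right_cancel (List.head_eq_of_cons_eq hw)
      have e := h.wordAct_eq.symm.trans h'.wordAct_eq
      rw [Option.some.injEq] at e
      have hp : p = p' := by
        clear h h' ih hw
        induction p generalizing p' with
        | nil =>
          cases p' with
          | nil => rfl
          | cons b p' => simp at e ha'; exact absurd e.1 ha'.1
        | cons b p ihp =>
          cases p' with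
          | nil => simp at e ha; exact absurd e.1.symm ha.1
          | cons b' p' =>
            simp only [List.cons_append, List.cons.injEq, List.mem_cons, not_or] at e ha ha'
            rw [e.1, ihp ha.2 p' ha'.2 e.2]
      rw [ih h', hp]

/-- The descents of the word are those of the tableau. -/
lemma descentSet_eq (h : Chain w γ τ) : descentSet γ τ = wordDes w := by
  ext v
  constructor
  · rintro ⟨i, j, i', j', h1, h2, rfl, h3, hj⟩
    have h4 := h.getElem?_eq h1
    have h5 := h.getElem?_eq h2
    rw [h3, Nat.add_sub_cancel] at h5
    obtain ⟨h6, h7⟩ := List.getElem?_eq_some_iff.1 h4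
    obtain ⟨h8, h9⟩ := List.getElem?_eq_some_iff.1 h5
    exact ⟨h.isSRCT.pos _ _ h1, h8, by rw [h7, h9]; exact Nat.succ_le_succ hj⟩
  · rintro ⟨h0, h1, h2⟩
    have h3 := h1
    rw [h.length_eq] at h3
    obtain ⟨i, j, hij, e⟩ := h.isSRCT.surj h0 h3.le
    obtain ⟨i', j', hij', e'⟩ := h.isSRCT.surj (Nat.succ_pos v) h3
    have h4 := h.getElem?_eq hij
    have h5 := h.getElem?_eq hij'
    rw [e'] at h5
    rw [e] at h4
    obtain ⟨h6, h7⟩ := List.getElem?_eq_some_iff.1 h4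
    obtain ⟨h8, h9⟩ := List.getElem?_eq_some_iff.1 h5
    simp only [Nat.succ_eq_add_one, Nat.add_sub_cancel] at h9
    rw [h7, h9] at h2
    exact ⟨i, j, i', j', hij, hij', e, e', Nat.succ_le_succ_iff.1 h2⟩

end Chain

lemma IsSRCT.exists_chain {γ : List ℕ+} {τ : ℕ → ℕ → ℕ} (h : IsSRCT γ τ) :
    ∃ w, Chain w γ τ := by
  induction hn : size γ generalizing γ τ with
  | zero =>
    have : γ = [] := List.length_eq_zero_iff.1 (Nat.le_zero.1 (hn ▸ length_le_size γ))
    subst this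
    rw [h.eq_zero]
    exact ⟨[], .nil⟩
  | succ n ih =>
    have hγ : γ ≠ [] := by
      rintro rfl
      simp at hn
    rcases h.exists_removal hγ with ⟨γ', τ', rfl, h1, rfl⟩ | ⟨p, s, a, τ', rfl, ha, h1, rfl⟩
    · obtain ⟨w, hw⟩ := ih h1 (by simp at hn; omega)
      exact ⟨_, hw.new⟩
    · obtain ⟨w, hw⟩ := ih h1 (by simp at hn ⊢; omega)
      exact ⟨_, hw.extend p s a ha⟩

lemma exists_chain_of_wordAct {w γ : List ℕ+} (h : wordAct w [] = some γ) : ∃ τ, Chain w γ τ := by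
  induction w generalizing γ with
  | nil =>
    obtain rfl : [] = γ := by simpa [wordAct] using h
    exact ⟨_, .nil⟩
  | cons i w ih =>
    obtain ⟨γ', h1, h2⟩ := wordAct_cons_eq_some_iff.1 h
    obtain ⟨τ, hτ⟩ := ih h1
    cases h2 with
    | new => exact ⟨_, hτ.new⟩
    | extend p s j hj => exact ⟨_, hτ.extend p s j hj⟩

/-- `d_{γ,β}` counts the words of descent composition `β` that build `γ` from the empty
composition. -/
lemma numSRCT_eq_ncard_words (γ β : List ℕ+) :
    numSRCT γ β = {w | wordAct w [] = some γ ∧ wordDes w = partialSums β}.ncard := by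
  refine Set.ncard_congr (fun τ h => Classical.choose (IsSRCT.exists_chain h.1)) ?_ ?_ ?_
  · intro τ h
    have hw := Classical.choose_spec (IsSRCT.exists_chain h.1)
    exact ⟨hw.wordAct_eq, by rw [← hw.descentSet_eq, h.2]⟩
  · intro τ τ' h h' e
    have hw := Classical.choose_spec (IsSRCT.exists_chain h.1)
    have hw' := Classical.choose_spec (IsSRCT.exists_chain h'.1)
    rw [← e] at hw'
    exact hw.tableau_unique hw'
  · rintro w ⟨h1, h2⟩
    obtain ⟨τ, hτ⟩ := exists_chain_of_wordAct h1
    have h3 : IsSRCT γ τ ∧ descentSet γ τ = partialSums β :=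
      ⟨hτ.isSRCT, by rw [hτ.descentSet_eq, h2]⟩
    exact ⟨τ, h3, (Classical.choose_spec (IsSRCT.exists_chain h3.1)).word_unique hτ⟩

/-! ### Reverse hookwords -/

lemma pairwise_le_take_iff {w : List ℕ+} {k : ℕ} : (w.take k).Pairwise (· ≤ ·) ↔
    ∀ i (h : i + 1 < w.length), i + 1 < k → w[i] ≤ w[i + 1] := by
  rw [← List.isChain_iff_pairwise, List.isChain_iff_getElem]
  simp only [List.length_take, List.getElem_take, lt_min_iff]
  exact ⟨fun h i h1 h2 => h i ⟨h2, h1⟩, fun h i h1 => h i h1.2 h1.1⟩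

lemma pairwise_gt_drop_iff {w : List ℕ+} {k : ℕ} : (w.drop k).Pairwise (· > ·) ↔
    ∀ i (h : i + 1 < w.length), k ≤ i → w[i + 1] < w[i] := by
  rw [← List.isChain_iff_pairwise, List.isChain_iff_getElem]
  simp only [List.length_drop, List.getElem_drop]
  constructor
  · intro h i h1 h2
    obtain ⟨j, rfl⟩ := Nat.exists_eq_add_of_le h2
    exact h j (by omega)
  · intro h i h1
    exact h (k + i) (by omega) (by omega)

/-- Reverse `k`-hookwords are the words with descent set `{1, …, k}`. -/
lemma mem_RHWk_iff_wordDes {n k : ℕ} (hk : k < n) {w : List ℕ+} : w ∈ RHWk n k ↔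
    w.length = n ∧ wordDes w = {x | 0 < x ∧ x ≤ k} := by
  rw [RHWk, Set.mem_ofPred_eq, pairwise_le_take_iff, pairwise_gt_drop_iff]
  refine and_congr_right fun hw => ?_
  constructor
  · rintro ⟨-, h1, h2⟩
    ext x
    constructor
    · rintro ⟨h0, hx, h3⟩
      obtain ⟨x, rfl⟩ := Nat.exists_eq_succ_of_ne_zero h0.ne'
      refine ⟨h0, ?_⟩
      by_contra hlt
      exact absurd h3 (not_le.2 (h2 x hx (by omega)))
    · rintro ⟨h0, hx⟩
      obtain ⟨x, rfl⟩ := Nat.exists_eq_succ_of_ne_zero h0.ne'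
      exact ⟨h0, by omega, h1 x (by omega) (by omega)⟩
  · intro h
    refine ⟨hk, fun i hi hik => ?_, fun i hi hik => ?_⟩
    · have : i + 1 ∈ wordDes w := by rw [h]; exact ⟨by omega, by omega⟩
      exact this.2.2
    · have : i + 1 ∉ wordDes w := by
        rw [h]
        rintro ⟨-, h⟩
        omega
      by_contra hlt
      exact this ⟨by omega, hi, not_lt.1 hlt⟩

lemma mem_RHWk_iff_exists {n k : ℕ} {w : List ℕ+} : w ∈ RHWk n k ↔
    ∃ X x Y, w = X ++ x :: Y ∧ X.length = k ∧ w.length = n ∧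
      (X ++ [x]).Pairwise (· ≤ ·) ∧ (x :: Y).Pairwise (· > ·) := by
  constructor
  · rintro ⟨rfl, hk, h1, h2⟩
    refine ⟨w.take k, w[k], w.drop (k + 1), by simp, by simp; omega, rfl, ?_, ?_⟩
    · rwa [← List.take_succ_eq_append_getElem hk]
    · rwa [← List.drop_eq_getElem_cons hk]
  · rintro ⟨X, x, Y, rfl, rfl, rfl, h1, h2⟩
    refine ⟨rfl, by simp, ?_, by simpa using h2⟩
    rwa [List.take_append, List.take_of_length_le (by omega), Nat.add_sub_cancel_left,
      List.take_succ_cons, List.take_zero]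

/-! ### Cancellation of the disconnected reverse hookwords -/

/-- The first `k` letters of `v` increase weakly and the others decrease strictly. -/
def IsArmLeg (v : List ℕ+) (k : ℕ) : Prop :=
  k ≤ v.length ∧ (v.take k).Pairwise (· ≤ ·) ∧ (v.drop k).Pairwise (· > ·)

lemma isArmLeg_iff {v : List ℕ+} {k : ℕ} : IsArmLeg v k ↔ k ≤ v.length ∧
    (∀ i (h : i + 1 < v.length), i + 1 < k → v[i] ≤ v[i + 1]) ∧
    ∀ i (h : i + 1 < v.length), k ≤ i → v[i + 1] < v[i] := by
  rw [IsArmLeg, pairwise_le_take_iff, pairwise_gt_drop_iff]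

lemma IsArmLeg.not_add_two {v : List ℕ+} {k : ℕ} (h : IsArmLeg v k) : ¬ IsArmLeg v (k + 1 + 1) := by
  intro h'
  rw [isArmLeg_iff] at h h'
  exact absurd (h'.2.1 k (by omega) (by omega)) (not_le.2 (h.2.2 k (by omega) le_rfl))

lemma IsArmLeg.succ_or_pred {v : List ℕ+} {k : ℕ} (h : IsArmLeg v k) (hv : v ≠ []) :
    IsArmLeg v (k + 1) ∨ ∃ l, k = l + 1 ∧ IsArmLeg v l := by
  have hlen := List.length_pos_iff.2 hv
  simp only [isArmLeg_iff] at h ⊢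
  obtain ⟨h1, h2, h3⟩ := h
  cases k with
  | zero => exact Or.inl ⟨hlen, fun i _ hi => by omega, fun i hi _ => h3 i hi (Nat.zero_le i)⟩
  | succ l =>
    by_cases hl : ∃ h : l + 1 < v.length, v[l] ≤ v[l + 1]
    · left
      obtain ⟨h4, h5⟩ := hl
      refine ⟨h4, fun i hi hil => ?_, fun i hi hil => h3 i hi (by omega)⟩
      rcases Nat.lt_or_ge i l with h6 | h6
      · exact h2 i hi (by omega)
      · obtain rfl : i = l := by omega
        exact h5
    · right
      refine ⟨l, rfl, by omega, fun i hi hil => h2 i hi (by omega), fun i hi hil => ?_⟩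
      rcases hil.lt_or_eq with h6 | rfl
      · exact h3 i hi h6
      · by_contra h7
        exact hl ⟨hi, not_lt.1 h7⟩

open Classical in
/-- A nonempty word that can be split into an arm and a leg can be so split in exactly two ways,
as its largest letter at the junction can be counted to either. This exchanges the two. -/
noncomputable def toggle (v : List ℕ+) (k : ℕ) : ℕ := if IsArmLeg v (k + 1) then k + 1 else k - 1

lemma IsArmLeg.toggle_spec {v : List ℕ+} {k : ℕ} (h : IsArmLeg v k) (hv : v ≠ []) :
    IsArmLeg v (toggle v k) ∧ toggle v (toggle v k) = k ∧
      (toggle v k = k + 1 ∨ k = toggle v k + 1) := by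
  by_cases h1 : IsArmLeg v (k + 1)
  · have e : toggle v k = k + 1 := if_pos h1
    rw [e]
    refine ⟨h1, ?_, Or.inl rfl⟩
    rw [toggle, if_neg h.not_add_two, Nat.add_sub_cancel]
  · obtain ⟨l, rfl, h2⟩ := (h.succ_or_pred hv).resolve_left h1
    have e : toggle v (l + 1) = l := if_neg h1
    rw [e]
    exact ⟨h2, if_pos h, Or.inr rfl⟩

/-- The word `u` inserted into the word `v` after its first `k` letters. -/
def insertAt (u v : List ℕ+) (k : ℕ) : List ℕ+ := v.take k ++ (u ++ v.drop k)

lemma insertAt_perm (u v : List ℕ+) (k : ℕ) : (insertAt u v k).Perm (u ++ v) := by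
  have h := (List.perm_append_comm (l₁ := v.take k) (l₂ := u)).append_right (v.drop k)
  rwa [List.append_assoc, List.append_assoc, List.take_append_drop] at h

lemma filter_lt_insertAt {u v : List ℕ+} {c : ℕ+} (hu : ∀ i ∈ u, c < i) (hv : ∀ i ∈ v, i < c)
    (k : ℕ) : (insertAt u v k).filter (· < c) = v := by
  have h1 : u.filter (· < c) = [] := List.filter_eq_nil_iff.2 fun i hi => by
    simpa using (hu i hi).le
  have h2 : v.filter (· < c) = v := List.filter_eq_self.2 fun i hi => by simpa using hv i hi
  rw [insertAt, List.filter_append, List.filter_append, h1, List.nil_append, ← List.filter_append,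
    List.take_append_drop, h2]

lemma filter_gt_insertAt {u v : List ℕ+} {c : ℕ+} (hu : ∀ i ∈ u, c < i) (hv : ∀ i ∈ v, i < c)
    (k : ℕ) : (insertAt u v k).filter (c < ·) = u := by
  have h1 : ∀ l : List ℕ+, (∀ i ∈ l, i ∈ v) → l.filter (c < ·) = [] := fun l hl =>
    List.filter_eq_nil_iff.2 fun i hi => by simpa using (hv i (hl i hi)).le
  rw [insertAt, List.filter_append, List.filter_append, h1 _ fun _ => List.mem_of_mem_take,
    h1 _ fun _ => List.mem_of_mem_drop, List.nil_append, List.append_nil]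
  exact List.filter_eq_self.2 fun i hi => by simpa using hu i hi

lemma takeWhile_insertAt {u v : List ℕ+} {c : ℕ+} (hu : ∀ i ∈ u, c < i) (hv : ∀ i ∈ v, i < c)
    (hne : u ≠ []) (k : ℕ) : (insertAt u v k).takeWhile (· < c) = v.take k := by
  rw [insertAt, List.takeWhile_append_of_pos
    (fun i hi => by simpa using hv i (List.mem_of_mem_take hi))]
  cases u with
  | nil => exact absurd rfl hne
  | cons b u =>
    have := hu b (by simp)
    rw [List.cons_append, List.takeWhile_cons_of_neg (by simpa using this.le), List.append_nil]

lemma eq_filter_append_of_pairwise_le {X : List ℕ+} {c : ℕ+} (h : X.Pairwise (· ≤ ·))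
    (hc : c ∉ X) : X = X.filter (· < c) ++ X.filter (c < ·) := by
  induction X with
  | nil => rfl
  | cons x X ih =>
    rw [List.pairwise_cons] at h
    simp only [List.mem_cons, not_or] at hc
    have ih := ih h.2 hc.2
    rcases lt_or_gt_of_ne hc.1 with h1 | h1
    · have h2 : X.filter (· < c) = [] := List.filter_eq_nil_iff.2 fun i hi => by
        simpa using h1.le.trans (h.1 i hi)
      rw [h2, List.nil_append] at ih
      rw [List.filter_cons_of_neg (by simpa using h1.le),
        List.filter_cons_of_pos (by simpa using h1), h2, List.nil_append, ← ih]
    · rw [List.filter_cons_of_pos (by simpa using h1),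
        List.filter_cons_of_neg (by simpa using h1.le), List.cons_append, ← ih]

lemma eq_filter_append_of_pairwise_gt {X : List ℕ+} {c : ℕ+} (h : X.Pairwise (· > ·))
    (hc : c ∉ X) : X = X.filter (c < ·) ++ X.filter (· < c) := by
  have h1 := eq_filter_append_of_pairwise_le (X := X.reverse) (c := c)
    (List.pairwise_reverse.2 (h.imp fun h => le_of_lt h)) (by simpa using hc)
  rw [← List.reverse_inj, List.reverse_append, ← List.filter_reverse, ← List.filter_reverse]
  exact h1

/-- If `c` is not a letter of a reverse hookword `w` but is smaller than its largest letter, then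
the letters greater than `c` form a reverse hookword, inserted into the word of the letters smaller
than `c` between an arm and a leg. -/
lemma exists_eq_insertAt {n m : ℕ} {w : List ℕ+} {c : ℕ+} (hw : w ∈ RHWk n m) (hc : c ∉ w)
    (hmax : ∃ b ∈ w, c < b) : ∃ k q, IsArmLeg (w.filter (· < c)) k ∧
      w = insertAt (w.filter (c < ·)) (w.filter (· < c)) k ∧
      w.filter (c < ·) ∈ RHWk (w.filter (c < ·)).length q := by
  obtain ⟨X, x, Y, rfl, -, -, hX, hY⟩ := mem_RHWk_iff_exists.1 hw
  have hXs := (List.pairwise_append.1 hX).1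
  have hYs := (List.pairwise_cons.1 hY).2
  have hx : c < x := by
    obtain ⟨b, hb, hcb⟩ := hmax
    refine hcb.trans_le ?_
    rcases List.mem_append.1 hb with h | h
    · exact (List.pairwise_append.1 hX).2.2 b h x (by simp)
    · rcases List.mem_cons.1 h with rfl | h
      · exact le_rfl
      · exact le_of_lt ((List.pairwise_cons.1 hY).1 b h)
  simp only [List.mem_append, List.mem_cons, not_or] at hc
  have eX := eq_filter_append_of_pairwise_le hXs hc.1
  have eY := eq_filter_append_of_pairwise_gt hYs hc.2.2
  have ev : (X ++ x :: Y).filter (· < c) = X.filter (· < c) ++ Y.filter (· < c) := by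
    rw [List.filter_append, List.filter_cons_of_neg (by simpa using hx.le)]
  have eu : (X ++ x :: Y).filter (c < ·) = X.filter (c < ·) ++ x :: Y.filter (c < ·) := by
    rw [List.filter_append, List.filter_cons_of_pos (by simpa using hx)]
  refine ⟨(X.filter (· < c)).length, (X.filter (c < ·)).length, ?_, ?_, ?_⟩
  · rw [ev]
    refine ⟨by simp, ?_, ?_⟩
    · rw [List.take_left]; exact hXs.filter _
    · rw [List.drop_left]; exact hYs.filter _
  · rw [ev, eu, insertAt, List.take_left, List.drop_left]
    conv_lhs => rw [eX, eY]
    simp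
  · refine mem_RHWk_iff_exists.2 ⟨_, x, _, eu, rfl, rfl, ?_, ?_⟩
    · have := hX.filter (c < ·)
      rwa [List.filter_append, List.filter_cons_of_pos (by simpa using hx), List.filter_nil] at this
    · have := hY.filter (c < ·)
      rwa [List.filter_cons_of_pos (by simpa using hx)] at this

lemma insertAt_mem_RHWk {u v : List ℕ+} {c : ℕ+} {p q k : ℕ} (hu : ∀ i ∈ u, c < i)
    (hv : ∀ i ∈ v, i < c) (h : u ∈ RHWk p q) (hk : IsArmLeg v k) :
    insertAt u v k ∈ RHWk (u ++ v).length (k + q) := by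
  obtain ⟨X, x, Y, rfl, rfl, -, hX, hY⟩ := mem_RHWk_iff_exists.1 h
  obtain ⟨h1, h2, h3⟩ := hk
  refine mem_RHWk_iff_exists.2 ⟨v.take k ++ X, x, Y ++ v.drop k, by simp [insertAt], by simp [h1],
    (insertAt_perm _ _ _).length_eq, ?_, ?_⟩
  · rw [List.append_assoc]
    refine List.pairwise_append.2 ⟨h2, hX, fun a ha b hb => ?_⟩
    exact ((hv a (List.mem_of_mem_take ha)).trans (hu b (by simp at hb ⊢; tauto))).le
  · rw [← List.cons_append]
    refine List.pairwise_append.2 ⟨hY, h3, fun a ha b hb => ?_⟩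
    exact (hv b (List.mem_of_mem_drop hb)).trans (hu a (by simp at ha ⊢; tauto))

/-- `c` is missing in `S`, while `S` has both smaller and greater elements. -/
def IsGap (S : Set ℕ+) (c : ℕ+) : Prop := c ∉ S ∧ (∃ a ∈ S, a < c) ∧ ∃ b ∈ S, c < b

lemma not_wordConnected_iff {w : List ℕ+} : ¬ WordConnected w ↔ ∃ c, IsGap {i | i ∈ w} c := by
  rw [WordConnected, Set.ordConnected_def]
  constructor
  · intro h
    push Not at h
    obtain ⟨a, ha, b, hb, h⟩ := h
    obtain ⟨c, hc, hcw⟩ := Set.not_subset.1 h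
    exact ⟨c, hcw, ⟨a, ha, lt_of_le_of_ne hc.1 fun e => hcw (e ▸ ha)⟩,
      ⟨b, hb, lt_of_le_of_ne hc.2 fun e => hcw (e ▸ hb)⟩⟩
  · rintro ⟨c, hc, ⟨a, ha, hac⟩, b, hb, hcb⟩ h
    exact hc (h ha hb ⟨hac.le, hcb.le⟩)

/-- A gap of `S`, chosen once and for all as a function of the set `S`. -/
noncomputable def gapOf (S : Set ℕ+) : ℕ+ := Classical.epsilon (IsGap S)

/-- The sign-reversing involution on disconnected reverse hookwords: for a gap `c` of the set of
letters, an occurrence of the largest letter smaller than `c`, adjacent to the block of the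
letters greater than `c`, moves to the other side of this block. -/
noncomputable def hookFlip (w : List ℕ+) : List ℕ+ :=
  let c := gapOf {i | i ∈ w}
  insertAt (w.filter (c < ·)) (w.filter (· < c))
    (toggle (w.filter (· < c)) (w.takeWhile (· < c)).length)

lemma hookFlip_insertAt {u v : List ℕ+} {k : ℕ} {c : ℕ+} (hc : gapOf {i | i ∈ insertAt u v k} = c)
    (hu : ∀ i ∈ u, c < i) (hv : ∀ i ∈ v, i < c) (hne : u ≠ []) (hk : k ≤ v.length) :
    hookFlip (insertAt u v k) = insertAt u v (toggle v k) := by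
  rw [hookFlip, hc, filter_lt_insertAt hu hv, filter_gt_insertAt hu hv, takeWhile_insertAt hu hv hne,
    List.length_take, min_eq_left hk]

/-- A disconnected reverse hookword and its image under `hookFlip` have a common form, except that
the arms differ in length by one. -/
lemma exists_hookFlip_eq {n m : ℕ} {w : List ℕ+} (hw : w ∈ RHWk n m) (hd : ¬ WordConnected w) :
    ∃ u v c k k' q, (∀ i ∈ u, c < i) ∧ (∀ i ∈ v, i < c) ∧ w = insertAt u v k ∧
      hookFlip w = insertAt u v k' ∧ hookFlip (hookFlip w) = w ∧ w ∈ RHWk n (k + q) ∧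
      hookFlip w ∈ RHWk n (k' + q) ∧ (k' = k + 1 ∨ k = k' + 1) := by
  obtain ⟨hc, ⟨a, ha, hac⟩, hb⟩ : IsGap {i | i ∈ w} (gapOf {i | i ∈ w}) :=
    Classical.epsilon_spec (not_wordConnected_iff.1 hd)
  obtain ⟨k, q, h1, h2, h3⟩ := exists_eq_insertAt hw hc hb
  have hn : w.length = n := hw.1
  generalize hcdef : gapOf {i | i ∈ w} = c at *
  have hu : ∀ i ∈ w.filter (c < ·), c < i := fun i hi => by simpa using (List.mem_filter.1 hi).2
  have hv : ∀ i ∈ w.filter (· < c), i < c := fun i hi => by simpa using (List.mem_filter.1 hi).2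
  have hv0 : w.filter (· < c) ≠ [] := List.ne_nil_of_mem (a := a)
    (List.mem_filter.2 ⟨ha, by simpa using hac⟩)
  have hu0 : w.filter (c < ·) ≠ [] := by
    obtain ⟨b, hb, hcb⟩ := hb
    exact List.ne_nil_of_mem (a := b) (List.mem_filter.2 ⟨hb, by simpa using hcb⟩)
  generalize w.filter (c < ·) = u at *
  generalize w.filter (· < c) = v at *
  subst h2
  obtain ⟨h4, h5, h6⟩ := h1.toggle_spec hv0
  have e := hookFlip_insertAt hcdef hu hv hu0 h1.1
  have hset : {i | i ∈ insertAt u v (toggle v k)} = {i | i ∈ insertAt u v k} := by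
    ext i
    exact ((insertAt_perm u v _).trans (insertAt_perm u v k).symm).mem_iff
  have hn' : (u ++ v).length = n := by rw [← hn, (insertAt_perm u v k).length_eq]
  refine ⟨u, v, c, k, toggle v k, q, hu, hv, rfl, e, ?_, ?_, ?_, h6⟩
  · rw [e, hookFlip_insertAt (by rw [hset, hcdef]) hu hv hu0 h4.1, h5]
  · rw [← hn']; exact insertAt_mem_RHWk hu hv h3 h1
  · rw [e, ← hn']; exact insertAt_mem_RHWk hu hv h3 h4

lemma insertAt_prod {A : Type*} [Monoid A] {T : ℕ+ → A}
    (hT : ∀ i j : ℕ+, i + 1 < j → Commute (T i) (T j)) {u v : List ℕ+} {c : ℕ+}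
    (hu : ∀ i ∈ u, c < i) (hv : ∀ i ∈ v, i < c) (k : ℕ) :
    ((insertAt u v k).map T).prod = (u.map T).prod * (v.map T).prod := by
  have h : Commute ((v.take k).map T).prod (u.map T).prod := by
    refine Commute.list_prod_left _ _ fun x hx => Commute.list_prod_right _ _ fun y hy => ?_
    obtain ⟨i, hi, rfl⟩ := List.mem_map.1 hx
    obtain ⟨j, hj, rfl⟩ := List.mem_map.1 hy
    exact hT i j ((PNat.add_one_le_iff.2 (hv i (List.mem_of_mem_take hi))).trans_lt (hu j hj))
  rw [insertAt, List.map_append, List.map_append, List.prod_append, List.prod_append, ← mul_assoc,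
    h.eq, mul_assoc, ← List.prod_append, ← List.map_append, List.take_append_drop]

open Classical in
/-- The disconnected reverse hookwords cancel in any algebra in which `T_i` and `T_j` commute for
`|i - j| ≥ 2`. -/
lemma sum_not_wordConnected_eq_zero {A : Type*} [Ring A] [Algebra ℚ A] {T : ℕ+ → A}
    (hT : ∀ i j : ℕ+, i + 1 < j → Commute (T i) (T j)) (N : ℕ+) (n : ℕ) :
    ∑ w ∈ words N n with w ∈ RHW n ∧ ¬ WordConnected w,
      (-1 : ℚ) ^ asc w • (w.map T).prod = 0 := by
  refine Finset.sum_involution (fun w _ => hookFlip w) ?_ ?_ ?_ ?_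
  · intro w hw
    obtain ⟨-, ⟨m, hm⟩, hd⟩ := Finset.mem_filter.1 hw
    obtain ⟨u, v, c, k, k', q, hu, hv, e, e', -, h1, h2, h3⟩ := exists_hookFlip_eq hm hd
    rw [asc_eq h1, asc_eq h2, e', e, insertAt_prod hT hu hv, insertAt_prod hT hu hv, ← add_smul]
    rcases h3 with rfl | rfl
    · rw [add_right_comm, pow_succ]; simp
    · rw [add_right_comm, pow_succ]; simp
  · intro w hw _ e
    obtain ⟨-, ⟨m, hm⟩, hd⟩ := Finset.mem_filter.1 hw
    obtain ⟨u, v, c, k, k', q, hu, hv, -, -, -, h1, h2, h3⟩ := exists_hookFlip_eq hm hd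
    rw [e] at h2
    have := RHWk_unique h1 h2
    omega
  · intro w hw
    obtain ⟨h0, ⟨m, hm⟩, hd⟩ := Finset.mem_filter.1 hw
    obtain ⟨u, v, c, k, k', q, hu, hv, e, e', -, -, h2, -⟩ := exists_hookFlip_eq hm hd
    have hmem : ∀ i, i ∈ hookFlip w ↔ i ∈ w := fun i => by
      rw [e', e]
      exact ((insertAt_perm u v _).trans (insertAt_perm u v k).symm).mem_iff
    refine Finset.mem_filter.2 ⟨mem_words.2 ⟨h2.1, fun i hi => ?_⟩, ⟨_, h2⟩, ?_⟩
    · exact (mem_words.1 h0).2 i ((hmem i).1 hi)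
    · rw [WordConnected] at hd ⊢
      simpa only [hmem] using hd
  · intro w hw
    obtain ⟨-, ⟨m, hm⟩, hd⟩ := Finset.mem_filter.1 hw
    obtain ⟨u, v, c, k, k', q, -, -, -, -, e, -⟩ := exists_hookFlip_eq hm hd
    exact e

/-! ### Sizes and letters of words acting on compositions -/

lemma CoverInColumn.size_eq {i : ℕ+} {α β : List ℕ+} (h : CoverInColumn i α β) :
    size β = size α + 1 := by
  cases h with
  | new => rw [size_cons, PNat.one_coe, add_comm]
  | extend p s j h => simp only [size_append, size_cons, PNat.add_coe, PNat.one_coe]; omega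

lemma CoverInColumn.mem {i : ℕ+} {α β : List ℕ+} (h : CoverInColumn i α β) : i ∈ β := by
  cases h <;> simp

lemma size_wordAct {w α γ : List ℕ+} (h : wordAct w α = some γ) :
    size γ = size α + w.length := by
  induction w generalizing γ with
  | nil =>
    obtain rfl : α = γ := by simpa [wordAct] using h
    rfl
  | cons i w ih =>
    obtain ⟨γ', h1, h2⟩ := wordAct_cons_eq_some_iff.1 h
    rw [h2.size_eq, ih h1, List.length_cons, add_assoc]

lemma le_size_of_wordAct {w α γ : List ℕ+} (h : wordAct w α = some γ) :
    ∀ i ∈ w, (i : ℕ) ≤ size γ := by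
  induction w generalizing γ with
  | nil => simp
  | cons i w ih =>
    obtain ⟨γ', h1, h2⟩ := wordAct_cons_eq_some_iff.1 h
    intro j hj
    rcases List.mem_cons.1 hj with rfl | hj
    · exact le_size_of_mem h2.mem
    · exact (ih h1 j hj).trans (by rw [h2.size_eq]; omega)

lemma mem_words_of_wordAct {w α : List ℕ+} {n : ℕ} {N : ℕ+} (hN : size α + n ≤ N)
    (hw : w.length = n) (h : wordAct w α ≠ none) : w ∈ words N n := by
  obtain ⟨γ, h⟩ := Option.ne_none_iff_exists'.1 h
  refine mem_words.2 ⟨hw, fun i hi => PNat.coe_le_coe _ _ |>.1 ?_⟩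
  refine (le_size_of_wordAct h i hi).trans ?_
  rwa [size_wordAct h, hw]

/-! ### Box-adding operators on the free module over compositions -/

/-- The basis vector of a composition, or `0`. -/
noncomputable def basisVec (o : Option (List ℕ+)) : List ℕ+ →₀ ℚ :=
  o.elim 0 fun α => Finsupp.single α 1

/-- The box-adding operator `𝔱_i` as a linear endomorphism of the free module over compositions. -/
noncomputable def boxOp (i : ℕ+) : Module.End ℚ (List ℕ+ →₀ ℚ) :=
  Finsupp.linearCombination ℚ fun α => basisVec (boxAdd i α)

lemma boxOp_basisVec (i : ℕ+) (o : Option (List ℕ+)) :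
    boxOp i (basisVec o) = basisVec (o.bind (boxAdd i)) := by
  cases o with
  | none => simp [basisVec]
  | some α => simp [basisVec, boxOp]

lemma boxOp_prod_basisVec (w α : List ℕ+) :
    (w.map boxOp).prod (basisVec (some α)) = basisVec (wordAct w α) := by
  induction w with
  | nil => rfl
  | cons i w ih =>
    rw [List.map_cons, List.prod_cons, Module.End.mul_apply, ih, boxOp_basisVec, wordAct_cons]

lemma extendPart_bind_comm {i j : ℕ+} (h : i + 1 < j) (α : List ℕ+) :
    (extendPart j α).bind (extendPart i) = (extendPart i α).bind (extendPart j) := by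
  have hij : i + 1 ≠ j := h.ne
  have hij' : i ≠ j := ((PNat.lt_add_right i 1).trans h).ne
  have hji : j + 1 ≠ i := fun e => by
    rw [← e] at h
    exact absurd h (not_lt.2 ((PNat.lt_add_right j 1).trans (PNat.lt_add_right _ 1)).le)
  induction α with
  | nil => rfl
  | cons a l ih =>
    by_cases h1 : a + 1 = i
    · subst h1
      have h2 : extendPart j (a :: l) = (extendPart j l).map (a :: ·) := by
        rw [extendPart, if_neg hij']
      rw [h2]
      cases h3 : extendPart j l <;> simp [extendPart, hij, h3]
    · by_cases h2 : a + 1 = j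
      · subst h2
        have h3 : extendPart i (a :: l) = (extendPart i l).map (a :: ·) := by
          rw [extendPart, if_neg h1]
        rw [h3]
        cases h4 : extendPart i l <;> simp [extendPart, hji, h4]
      · have h3 : ∀ l', extendPart i (a :: l') = (extendPart i l').map (a :: ·) := fun l' => by
          rw [extendPart, if_neg h1]
        have h4 : ∀ l', extendPart j (a :: l') = (extendPart j l').map (a :: ·) := fun l' => by
          rw [extendPart, if_neg h2]
        rw [h3, h4, Option.bind_map, Option.bind_map]
        have h5 := congrArg (Option.map (a :: ·)) ih
        rw [Option.map_bind, Option.map_bind] at h5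
        simpa only [Function.comp_def, h3, h4] using h5

lemma boxAdd_bind_comm {i j : ℕ+} (h : i + 1 < j) (α : List ℕ+) :
    (boxAdd j α).bind (boxAdd i) = (boxAdd i α).bind (boxAdd j) := by
  have hj : j ≠ 1 := fun e => absurd h (by rw [e]; exact not_lt.2 one_le)
  have hbj : boxAdd j = extendPart j := by funext α; rw [boxAdd, if_neg hj]
  rw [hbj]
  by_cases hi : i = 1
  · subst hi
    have h1 : ∀ α, boxAdd 1 α = some (1 :: α) := fun α => if_pos rfl
    have h2 : extendPart j (1 :: α) = (extendPart j α).map (1 :: ·) := by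
      rw [extendPart, if_neg h.ne]
    rw [h1, Option.bind_some, h2]
    cases extendPart j α <;> simp [h1]
  · have hbi : boxAdd i = extendPart i := by funext α; rw [boxAdd, if_neg hi]
    rw [hbi, extendPart_bind_comm h]

lemma boxOp_commute (i j : ℕ+) (h : i + 1 < j) : Commute (boxOp i) (boxOp j) := by
  refine Finsupp.lhom_ext' fun α => LinearMap.ext_ring ?_
  have h1 := boxOp_prod_basisVec [i, j] α
  have h2 := boxOp_prod_basisVec [j, i] α
  simp only [List.map_cons, List.map_nil, List.prod_cons, List.prod_nil, mul_one] at h1 h2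
  exact h1.trans ((congrArg basisVec (boxAdd_bind_comm h α)).trans h2.symm)

/-! ### The action of the box-adding operators is left multiplication -/

/-- The linear map sending the basis vector of `α` to `s_α`. -/
noncomputable def schurMap : (List ℕ+ →₀ ℚ) →ₗ[ℚ] NSym := Finsupp.linearCombination ℚ ncSchur

lemma schurMap_basisVec (o : Option (List ℕ+)) : schurMap (basisVec o) = toNSym o := by
  cases o <;> simp [schurMap, basisVec, toNSym]

lemma descentSum_boxOp_apply (N : ℕ+) (n : ℕ) (D : Set ℕ) (α : List ℕ+)
    [DecidablePred fun w => wordDes w = D] :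
    descentSum boxOp N n D (basisVec (some α)) =
      ∑ w ∈ words N n with wordDes w = D, basisVec (wordAct w α) := by
  rw [descentSum, LinearMap.sum_apply]
  refine Finset.sum_congr (by congr) fun w _ => boxOp_prod_basisVec w α

/-- The words of descent composition `β` applied to the empty composition give the tableaux of
descent composition `β`. -/
lemma wordHom_ribbon_apply_nil {N : ℕ+} {β : List ℕ+} (hN : size β ≤ N) :
    wordHom boxOp N (ribbon β) (basisVec (some [])) =
      ∑ γ : CompOf (size β), (numSRCT γ.1 β : ℚ) • basisVec (some γ.1) := by
  classical
  have h1 : ∀ w ∈ words N (size β), basisVec (wordAct w []) =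
      ∑ γ : CompOf (size β), if wordAct w [] = some γ.1 then basisVec (some γ.1) else 0 := by
    intro w hw
    cases hγ : wordAct w [] with
    | none => simp [basisVec]
    | some γ =>
      have hs : size γ = size β := by
        rw [size_wordAct hγ, size_nil, zero_add, (mem_words.1 hw).1]
      rw [Finset.sum_eq_single (⟨γ, hs⟩ : CompOf (size β)), if_pos rfl]
      · intro δ _ hδ
        rw [if_neg]
        intro e
        exact hδ (Subtype.ext (Option.some.inj e).symm)
      · simp
  rw [wordHom_ribbon, descentSum_boxOp_apply,
    Finset.sum_congr rfl fun w hw => h1 w (Finset.mem_filter.1 hw).1, Finset.sum_comm]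
  refine Finset.sum_congr rfl fun γ _ => ?_
  rw [← Finset.sum_filter, Finset.sum_const, numSRCT_eq_ncard_words, Nat.cast_smul_eq_nsmul,
    ← Set.ncard_coe_finset]
  congr 2
  ext w
  simp only [Finset.coe_filter, Finset.mem_filter, Set.mem_ofPred_eq]
  constructor
  · rintro ⟨⟨-, h2⟩, h3⟩
    exact ⟨h3, h2⟩
  · rintro ⟨h2, h3⟩
    have hlen : w.length = size β := by
      have := size_wordAct h2
      rw [γ.2, size_nil, zero_add] at this
      exact this.symm
    exact ⟨⟨mem_words_of_wordAct (α := []) (by simpa using hN) hlen (by simp [h2]), h3⟩, h2⟩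

lemma schurMap_wordHom_apply_nil {N : ℕ+} {n : ℕ} (hN : n ≤ N) {x : NSym} (hx : x ∈ ribbonSpan n) :
    schurMap (wordHom boxOp N x (basisVec (some []))) = x := by
  induction hx using Submodule.span_induction with
  | mem x h =>
    obtain ⟨β, rfl, rfl⟩ := h
    rw [wordHom_ribbon_apply_nil hN, map_sum, ribbon_eq_sum_ncSchur β]
    refine Finset.sum_congr rfl fun γ _ => ?_
    rw [map_smul, schurMap_basisVec, Nat.cast_smul_eq_nsmul]
    rfl
  | zero => simp
  | add x y _ _ hx hy => rw [map_add, LinearMap.add_apply, map_add, hx, hy]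
  | smul c x _ hx => rw [map_smul, LinearMap.smul_apply, map_smul, hx]

lemma wordHom_ncSchur_apply_nil {N : ℕ+} {α : List ℕ+} (hN : size α ≤ N) :
    wordHom boxOp N (ncSchur α) (basisVec (some [])) = basisVec (some α) := by
  have hdet : IsUnit (dMatrix (size α)).det := by rw [det_dMatrix]; exact isUnit_one
  have h : ∀ β : CompOf (size α), wordHom boxOp N (ribbon β.1) (basisVec (some [])) =
      ∑ γ : CompOf (size α), dMatrix (size α) γ β • basisVec (some γ.1) := by
    rintro ⟨β, hβ⟩
    have h := wordHom_ribbon_apply_nil (N := N) (β := β) (by rw [hβ]; exact hN)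
    rw [hβ] at h
    exact h
  rw [ncSchur, map_sum, LinearMap.sum_apply]
  calc ∑ β : CompOf (size α), wordHom boxOp N ((dMatrix (size α))⁻¹ β ⟨α, rfl⟩ • ribbon β.1)
          (basisVec (some []))
      = ∑ β : CompOf (size α), ∑ γ : CompOf (size α),
          (dMatrix (size α) γ β * (dMatrix (size α))⁻¹ β ⟨α, rfl⟩) • basisVec (some γ.1) := by
        refine Finset.sum_congr rfl fun β _ => ?_
        rw [map_smul, LinearMap.smul_apply, h, Finset.smul_sum]
        exact Finset.sum_congr rfl fun γ _ => by rw [smul_smul, mul_comm]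
    _ = ∑ γ : CompOf (size α), (1 : Matrix (CompOf (size α)) (CompOf (size α)) ℚ) γ ⟨α, rfl⟩ •
          basisVec (some γ.1) := by
        rw [Finset.sum_comm, ← Matrix.mul_nonsing_inv _ hdet]
        refine Finset.sum_congr rfl fun γ _ => ?_
        rw [Matrix.mul_apply, Finset.sum_smul]
    _ = basisVec (some α) := by simp [Matrix.one_apply]

/-- The product `r_β s_α` is the result of applying all words of descent composition `β`
to `α`. -/
lemma ribbon_mul_ncSchur {N : ℕ+} {α β : List ℕ+} (hN : size α + size β ≤ N)
    [DecidablePred fun w => wordDes w = partialSums β] :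
    ribbon β * ncSchur α =
      ∑ w ∈ words N (size β) with wordDes w = partialSums β, toNSym (wordAct w α) := by
  have hx := ribbon_mul_mem_ribbonSpan β (ncSchur_mem_ribbonSpan α)
  rw [← schurMap_wordHom_apply_nil (N := N) (by omega) hx, map_mul, Module.End.mul_apply,
    wordHom_ncSchur_apply_nil (by omega), wordHom_ribbon, descentSum_boxOp_apply, map_sum]
  exact Finset.sum_congr rfl fun w _ => schurMap_basisVec _

/-! ### Hooks -/

lemma size_hookComp {n k : ℕ} (hk : k < n) : size (hookComp n k hk) = n := by
  have h1 : size (List.replicate k 1) = k := by simp [size]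
  refine (size_append _ _).trans ?_
  rw [h1]
  refine (congrArg (k + ·) (size_singleton _)).trans ?_
  exact Nat.add_sub_of_le hk.le

lemma partialSums_replicate_one_append (k : ℕ) (a : ℕ+) :
    partialSums (List.replicate k 1 ++ [a]) = {x | 0 < x ∧ x ≤ k} := by
  induction k with
  | zero =>
    rw [List.replicate_zero, List.nil_append, partialSums_singleton]
    ext x
    simp
    omega
  | succ k ih =>
    obtain ⟨b, γ, h⟩ : ∃ b γ, List.replicate k 1 ++ [a] = b :: γ :=
      List.exists_cons_of_ne_nil (by simp)
    ext x
    rw [List.replicate_succ, List.cons_append, h, mem_partialSums_cons_cons, ← h, ih]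
    simp only [Set.mem_ofPred_eq, PNat.one_coe]
    constructor
    · rintro (rfl | ⟨y, hy, rfl⟩) <;> omega
    · intro hx
      by_cases h1 : x = 1
      · exact Or.inl h1
      · exact Or.inr ⟨x - 1, by omega, by omega⟩

lemma ribbon_hookComp_mul_ncSchur {N : ℕ+} {n k : ℕ} (hk : k < n) {α : List ℕ+}
    (hN : size α + n ≤ N) [DecidablePred (· ∈ RHWk n k)] :
    ribbon (hookComp n k hk) * ncSchur α =
      ∑ w ∈ words N n with w ∈ RHWk n k, toNSym (wordAct w α) := by
  classical
  rw [ribbon_mul_ncSchur (N := N) (by rwa [size_hookComp]), size_hookComp]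
  refine Finset.sum_congr ?_ fun _ _ => rfl
  ext w
  simp only [Finset.mem_filter]
  refine and_congr_right fun hw => ?_
  have h : partialSums (hookComp n k hk) = {x | 0 < x ∧ x ≤ k} :=
    partialSums_replicate_one_append k _
  rw [mem_RHWk_iff_wordDes hk, h]
  exact (and_iff_right (mem_words.1 hw).1).symm

open Classical in
lemma psi_mul_ncSchur {N : ℕ+} {n : ℕ} {α : List ℕ+} (hN : size α + n ≤ N) :
    psi n * ncSchur α =
      ∑ w ∈ words N n with w ∈ CRHW n, (-1 : ℚ) ^ asc w • toNSym (wordAct w α) := by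
  have hRHW : psi n * ncSchur α =
      ∑ w ∈ words N n with w ∈ RHW n, (-1 : ℚ) ^ asc w • toNSym (wordAct w α) := by
    have h1 : ∀ w : List ℕ+, (if w ∈ RHW n then (-1 : ℚ) ^ asc w • toNSym (wordAct w α) else 0) =
        ∑ k : Fin n, if w ∈ RHWk n k then (-1 : ℚ) ^ (k : ℕ) • toNSym (wordAct w α) else 0 := by
      intro w
      split_ifs with h
      · obtain ⟨k, hk⟩ := h
        have hkn : k < n := hk.2.1
        rw [Finset.sum_eq_single (⟨k, hkn⟩ : Fin n), if_pos hk, asc_eq hk]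
        · intro l _ hl
          rw [if_neg]
          intro h
          exact hl (Fin.ext (RHWk_unique h hk))
        · simp
      · refine (Finset.sum_eq_zero fun k _ => if_neg fun hk => h ⟨_, hk⟩).symm
    rw [Finset.sum_filter, Finset.sum_congr rfl fun w _ => h1 w, Finset.sum_comm, psi,
      Finset.sum_mul]
    refine Finset.sum_congr rfl fun k _ => ?_
    rw [smul_mul_assoc, ribbon_hookComp_mul_ncSchur k.2 hN, Finset.smul_sum, Finset.sum_filter]
  have hdisc : ∑ w ∈ words N n with w ∈ RHW n ∧ ¬ WordConnected w,
      (-1 : ℚ) ^ asc w • toNSym (wordAct w α) = 0 := by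
    have h := congrArg (fun f => schurMap (f (basisVec (some α))))
      (sum_not_wordConnected_eq_zero boxOp_commute N n)
    simpa only [LinearMap.sum_apply, LinearMap.smul_apply, boxOp_prod_basisVec, map_sum, map_smul,
      schurMap_basisVec, LinearMap.zero_apply, map_zero] using h
  rw [hRHW, ← Finset.sum_filter_add_sum_filter_not _ WordConnected, Finset.filter_filter,
    Finset.filter_filter, hdisc, add_zero]
  refine Finset.sum_congr (Finset.filter_congr fun w _ => ?_) fun _ _ => rfl
  rfl

open Classical in
lemma finsum_mem_eq_sum_words {N : ℕ+} {n : ℕ} {α : List ℕ+} (hN : size α + n ≤ N)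
    {S : Set (List ℕ+)} (hS : ∀ w ∈ S, w.length = n) (f : List ℕ+ → NSym)
    (hf : ∀ w, wordAct w α = none → f w = 0) :
    ∑ᶠ w ∈ S, f w = ∑ w ∈ words N n with w ∈ S, f w := by
  refine finsum_mem_eq_sum_of_inter_support_eq f ?_
  ext w
  simp only [Set.mem_inter_iff, Function.mem_support, Finset.coe_filter, Set.mem_ofPred_eq]
  constructor
  · rintro ⟨h1, h2⟩
    exact ⟨⟨mem_words_of_wordAct hN (hS w h1) fun h => h2 (hf w h), h1⟩, h2⟩
  · rintro ⟨⟨-, h1⟩, h2⟩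
    exact ⟨h1, h2⟩

lemma finite_wordAct_ne_none {n : ℕ} {S : Set (List ℕ+)} (hS : ∀ w ∈ S, w.length = n)
    (α : List ℕ+) : {w | w ∈ S ∧ wordAct w α ≠ none}.Finite :=
  (words ⟨size α + n + 1, Nat.succ_pos _⟩ n).finite_toSet.subset fun w h =>
    mem_words_of_wordAct (α := α) (by simp) (hS w h.1) h.2

end NSymMN

theorem mainTheorem3 (n : ℕ) (hn : 0 < n) (α : List ℕ+) :
    (∀ (k : ℕ) (hk : k < n),
      {w | w ∈ NSymMN.RHWk n k ∧ NSymMN.wordAct w α ≠ none}.Finite ∧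
      NSymMN.ribbon (NSymMN.hookComp n k hk) * NSymMN.ncSchur α =
        ∑ᶠ w ∈ NSymMN.RHWk n k, NSymMN.toNSym (NSymMN.wordAct w α)) ∧
    {w | w ∈ NSymMN.CRHW n ∧ NSymMN.wordAct w α ≠ none}.Finite ∧
    NSymMN.psi n * NSymMN.ncSchur α =
      ∑ᶠ w ∈ NSymMN.CRHW n,
        (-1 : ℚ) ^ NSymMN.asc w • NSymMN.toNSym (NSymMN.wordAct w α) := by
  classical
  have hN : NSymMN.size α + n ≤ (⟨NSymMN.size α + n, by omega⟩ : ℕ+) := le_rfl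
  have hzero : ∀ w, NSymMN.wordAct w α = none → NSymMN.toNSym (NSymMN.wordAct w α) = 0 :=
    fun w h => by rw [h]; rfl
  have hC : ∀ w ∈ NSymMN.CRHW n, w.length = n := by
    rintro w ⟨⟨k, hk⟩, -⟩
    exact hk.1
  refine ⟨fun k hk => ⟨NSymMN.finite_wordAct_ne_none (fun w h => h.1) α, ?_⟩,
    NSymMN.finite_wordAct_ne_none hC α, ?_⟩
  · rw [NSymMN.ribbon_hookComp_mul_ncSchur hk hN,
      NSymMN.finsum_mem_eq_sum_words hN (fun w h => h.1) _ hzero]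
  · rw [NSymMN.psi_mul_ncSchur hN, NSymMN.finsum_mem_eq_sum_words hN hC]
    intro w h
    rw [hzero w h, smul_zero]
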